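/- Let $k$ be a field and $s\ge 1$. For a commutative $k$-algebra $R$ let $\mathfrak G^s(R)$ be the set of formal power series $f=\sum_{|w|\ge 1}f_w z_w$ without constant term in $s$ non-commuting variables $z_1,\dots,z_s$ ($w$ runs over the words in the letters $1,\dots,s$) whose coefficients $f_{1},\dots,f_{s}$ of $z_1,\dots,z_s$ are units of $R$, with the boxed convolution $$(f\boxtimes g)_w=\sum_{\pi\in NC(|w|)}\ \prod_{V\in\pi}f_{w|V}\ \prod_{W\in K(\pi)}g_{w|W},$$ where $NC(n)$ is the set of non-crossing partitions of $\{1,\dots,n\}$, $K(\pi)$ is the Kreweras complement and $w|V$ is the subword of $w$ at the positions in $V$. Let $\mathbb B_N(R)\subset GL_N(R)$ be the group of invertible upper-triangular matrices and $\mathbb B_\infty(R)=\varprojlim_N\mathbb B_N(R)$, the transition maps being truncation to the upper left block. An upper-triangular representation is a family of maps $\rho_R:\mathfrak G^s(R)\to\mathbb B_\infty(R)$, natural in the commutative $k$-algebra $R$, with $\rho_R(f\boxtimes g)=\rho_R(f)\rho_R(g)$; it is faithful if all $\rho_R$ are injective, and minimal faithful if moreover its degree is the least possible, i.e. (this degree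 being countably infinite) $\mathfrak G^s$ has no faithful representation $\mathfrak G^s\to GL_N$ over $k$ with $N$ finite. Let $\mathcal A$ be a unital associative $k$-algebra and $\phi:\mathcal A\to k$ a $k$-linear functional with $\phi(1)=1$. The free cumulants $\kappa_n:\mathcal A^n\to k$ are defined recursively by $\phi(c_1\cdots c_n)=\sum_{\pi\in NC(n)}\prod_{V\in\pi}\kappa_{|V|}(c_v: v\in V)$. Subsets $M_1,M_2\subset\mathcal A$ are combinatorially free if $\kappa_m(c_1,\dots,c_m)=0$ whenever $c_j\in M_{i_j}$ for all $j$ and the indices $i_1,\dots,i_m\in\{1,2\}$ are not all equal. For $a=(a_1,\dots,a_s)\in\mathcal A^s$ put $\mathcal R(a)=\sum_{|w|\ge1}\kappa_{|w|}(a_w)z_w$, where $a_w=(a_{i_1},\dots,a_{i_n})$ for $w=i_1\dots i_n$. If $\phi(a_i)\neq0$ for all $i$, then $\mathcal R(a)\in\mathfrak G^s(k)$, and for a faithful upper-triangular representation $\rho$ one sets $\mathcal S(a)=\rho_k(\mathcal R(a))\in\varprojlim_N\mathbb B_N(k)$, the $\mathcal S$-transform of $a$. **Theorem.** A minimal faithful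 upper-triangular representation $\rho$ of $\mathfrak G^s$ exists. For every faithful upper-triangular representation $\rho$ (in particular for every minimal one), for every $(\mathcal A,\phi)$ as above and all $a,b\in\mathcal A^s$ with $\phi(a_i)\ne0$ and $\phi(b_i)\neq0$ for $i=1,\dots,s$: 1. (faithfulness) $\mathcal S(a)=\mathcal S(b)$ if and only if $a$ and $b$ have the same joint distribution, i.e. $\phi(a_{i_1}\cdots a_{i_n})=\phi(b_{i_1}\cdots b_{i_n})$ for all words $i_1\dots i_n$. 2. (multiplicativity) If the sets $\{a_1,\dots,a_s\}$ and $\{b_1,\dots,b_s\}$ are combinatorially free, then $a\star b=(a_1b_1,\dots,a_sb_s)$ satisfies $\phi(a_ib_i)\ne0$ for all $i$, and $$\mathcal S(a\star b)=\mathcal S(a)\cdot\mathcal S(b).$$ -/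

import Mathlib

universe u v

open Finset

/-! ### Non-crossing partitions and the Kreweras complement -/

/-- Partitions of the set `[n]`, realised as `Fin n`. -/
abbrev SetPart (n : ℕ) : Type := Finpartition (Finset.univ : Finset (Fin n))

namespace SetPart

/-- `p` and `q` lie in a common block of `π`. -/
def Rel {n : ℕ} (π : SetPart n) (p q : Fin n) : Prop := ∃ V ∈ π.parts, p ∈ V ∧ q ∈ V

/-- A relation on a totally ordered set is non-crossing if `p₁ < q₁ < p₂ < q₂`, `p₁ ∼ p₂` and
`q₁ ∼ q₂` imply `p₂ ∼ q₁`. -/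
def NonCrossingRel {α : Type*} [LinearOrder α] (r : α → α → Prop) : Prop :=
  ∀ p₁ q₁ p₂ q₂ : α, p₁ < q₁ → q₁ < p₂ → p₂ < q₂ → r p₁ p₂ → r q₁ q₂ → r p₂ q₁

/-- Non-crossing partitions. -/
def IsNonCrossing {n : ℕ} (π : SetPart n) : Prop := NonCrossingRel π.Rel

open Classical in
/-- The finite set `NC(n)`. -/
noncomputable def NC (n : ℕ) : Finset (SetPart n) := Finset.univ.filter IsNonCrossing

/-- The equivalence relation of the Kreweras complement: for `i < j`, `i ∼ j` iff the interval
`{i + 1, …, j}` is a union of blocks of `π`. -/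
def krewerasSetoid {n : ℕ} (π : SetPart n) : Setoid (Fin n) where
  r i j := ∀ p q, π.Rel p q → ((p ≤ i ↔ p ≤ j) ↔ (q ≤ i ↔ q ≤ j))
  iseqv :=
    { refl := fun _ _ _ _ => by tauto
      symm := fun h p q hpq => by have := h p q hpq; tauto
      trans := fun h h' p q hpq => by have := h p q hpq; have := h' p q hpq; tauto }

open Classical in
/-- The Kreweras complement `K(π)`. Its defining property (the largest non-crossing partition of
the interlaced copy of `[n]` whose union with `π` is non-crossing) is `kreweras_isGreatest`. -/
noncomputable def kreweras {n : ℕ} (π : SetPart n) : SetPart n :=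
  Finpartition.ofSetoid π.krewerasSetoid

/-- The relation of the partition `π ∪ σ` of `1 < 1̄ < 2 < 2̄ < ⋯ < n < n̄`, where `π` partitions
the unbarred points `(i, false)` and `σ` the barred points `(i, true)`. -/
def UnionRel {n : ℕ} (π σ : SetPart n) (x y : Fin n ×ₗ Bool) : Prop :=
  ((ofLex x).2 = false ∧ (ofLex y).2 = false ∧ π.Rel (ofLex x).1 (ofLex y).1) ∨
  ((ofLex x).2 = true ∧ (ofLex y).2 = true ∧ σ.Rel (ofLex x).1 (ofLex y).1)

theorem rel_symm {n : ℕ} {π : SetPart n} {p q : Fin n} (h : π.Rel p q) : π.Rel q p := by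
  obtain ⟨V, hV, h1, h2⟩ := h
  exact ⟨V, hV, h2, h1⟩

theorem rel_trans {n : ℕ} {π : SetPart n} {p q r : Fin n} (h : π.Rel p q) (h' : π.Rel q r) :
    π.Rel p r := by
  obtain ⟨V, hV, h1, h2⟩ := h
  obtain ⟨W, hW, h3, h4⟩ := h'
  have : V = W := π.disjoint.elim_finset hV hW q h2 h3
  exact ⟨V, hV, h1, this ▸ h4⟩

theorem kreweras_rel {n : ℕ} (π : SetPart n) (i j : Fin n) :
    π.kreweras.Rel i j ↔ π.krewerasSetoid.r i j := by
  classical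
  rw [← Finpartition.mem_part_ofSetoid_iff_rel (s := π.krewerasSetoid)]
  unfold Rel kreweras
  rw [Finpartition.mem_part_iff_exists]
  constructor
  · rintro ⟨V, hV, h1, h2⟩
    exact ⟨V, by convert hV, h2, h1⟩
  · rintro ⟨V, hV, h1, h2⟩
    exact ⟨V, by convert hV, h2, h1⟩

theorem kreweras_isGreatest {n : ℕ} (π : SetPart n) (hπ : π.IsNonCrossing) :
    IsGreatest {σ : SetPart n | σ.IsNonCrossing ∧ NonCrossingRel (UnionRel π σ)} π.kreweras := by
  have key : NonCrossingRel (UnionRel π π.kreweras) → π.kreweras.IsNonCrossing := by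
    intro h p₁ q₁ p₂ q₂ h1 h2 h3 h4 h5
    have := h (toLex (p₁, true)) (toLex (q₁, true)) (toLex (p₂, true)) (toLex (q₂, true))
      (by simp [Prod.Lex.toLex_lt_toLex, h1]) (by simp [Prod.Lex.toLex_lt_toLex, h2])
      (by simp [Prod.Lex.toLex_lt_toLex, h3]) (by simp [UnionRel, h4]) (by simp [UnionRel, h5])
    simpa [UnionRel] using this
  have hun : NonCrossingRel (UnionRel π π.kreweras) := by
    rintro ⟨p₁, b₁⟩ ⟨q₁, c₁⟩ ⟨p₂, b₂⟩ ⟨q₂, c₂⟩ h1 h2 h3 h4 h5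
    change toLex _ < toLex _ at h1
    change toLex _ < toLex _ at h2
    change toLex _ < toLex _ at h3
    rw [Prod.Lex.toLex_lt_toLex] at h1 h2 h3
    have l1 : p₁ ≤ q₁ := h1.elim le_of_lt fun h => h.1.le
    have l2 : q₁ ≤ p₂ := h2.elim le_of_lt fun h => h.1.le
    have l3 : p₂ ≤ q₂ := h3.elim le_of_lt fun h => h.1.le
    simp only [UnionRel, kreweras_rel] at h4 h5 ⊢
    rcases h4 with ⟨rfl, rfl, h4⟩ | ⟨rfl, rfl, h4⟩ <;>
      rcases h5 with ⟨rfl, rfl, h5⟩ | ⟨rfl, rfl, h5⟩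
    · left
      refine ⟨rfl, rfl, hπ p₁ q₁ p₂ q₂ ?_ ?_ ?_ h4 h5⟩ <;> simp_all
    · exfalso
      have this : (p₁ ≤ q₁ ↔ p₁ ≤ q₂) ↔ (p₂ ≤ q₁ ↔ p₂ ≤ q₂) := h5 p₁ p₂ h4
      have l2' : q₁ < p₂ := h2.resolve_right fun h => absurd h.2 (show ¬ ((true : Bool) < false) by decide)
      clear h1 h2 h3 h4 h5
      grind
    · exfalso
      have this : (q₁ ≤ p₁ ↔ q₁ ≤ p₂) ↔ (q₂ ≤ p₁ ↔ q₂ ≤ p₂) := h4 q₁ q₂ h5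
      have l1' : p₁ < q₁ := h1.resolve_right fun h => absurd h.2 (show ¬ ((true : Bool) < false) by decide)
      have l3' : p₂ < q₂ := h3.resolve_right fun h => absurd h.2 (show ¬ ((true : Bool) < false) by decide)
      clear h1 h2 h3 h4 h5
      grind
    · right
      refine ⟨rfl, rfl, ?_⟩
      intro x y hxy
      have e1 : (x ≤ p₁ ↔ x ≤ p₂) ↔ (y ≤ p₁ ↔ y ≤ p₂) := h4 x y hxy
      have e2 : (x ≤ q₁ ↔ x ≤ q₂) ↔ (y ≤ q₁ ↔ y ≤ q₂) := h5 x y hxy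
      change (x ≤ p₂ ↔ x ≤ q₁) ↔ (y ≤ p₂ ↔ y ≤ q₁)
      simp at h1 h2 h3
      omega
  refine ⟨⟨key hun, hun⟩, ?_⟩
  rintro σ ⟨hσ, hu⟩ V hV
  have main : ∀ i j : Fin n, i < j → σ.Rel i j → ∀ p q, π.Rel p q → p < q →
      ((p ≤ i ↔ p ≤ j) ↔ (q ≤ i ↔ q ≤ j)) := by
    intro i j hij hr p q hpq hlt
    have a1 : p ≤ i → i < q → q ≤ j → False := by
      intro h1 h2 h3
      have := hu (toLex (p, false)) (toLex (i, true)) (toLex (q, false)) (toLex (j, true))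
        (by simp [Prod.Lex.toLex_lt_toLex]; omega) (by simp [Prod.Lex.toLex_lt_toLex]; omega)
        (by simp [Prod.Lex.toLex_lt_toLex]; omega) (by simp [UnionRel, hpq])
        (by simp [UnionRel, hr])
      simp [UnionRel] at this
    have a2 : i < p → p ≤ j → j < q → False := by
      intro h1 h2 h3
      have := hu (toLex (i, true)) (toLex (p, false)) (toLex (j, true)) (toLex (q, false))
        (by simp [Prod.Lex.toLex_lt_toLex]; omega) (by simp [Prod.Lex.toLex_lt_toLex]; omega)
        (by simp [Prod.Lex.toLex_lt_toLex]; omega) (by simp [UnionRel, hr])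
        (by simp [UnionRel, hpq])
      simp [UnionRel] at this
    grind
  have main' : ∀ i j : Fin n, σ.Rel i j → π.krewerasSetoid.r i j := by
    intro i j hr p q hpq
    rcases lt_trichotomy p q with h | h | h
    · rcases lt_trichotomy i j with h' | h' | h'
      · exact main i j h' hr p q hpq h
      · subst h'; simp
      · have := main j i h' (rel_symm hr) p q hpq h
        omega
    · subst h; simp
    · rcases lt_trichotomy i j with h' | h' | h'
      · have := main i j h' hr q p (rel_symm hpq) h
        omega
      · subst h'; simp
      · have := main j i h' (rel_symm hr) q p (rel_symm hpq) h
        omega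
  obtain ⟨v, hv⟩ := σ.nonempty_of_mem_parts hV
  refine ⟨π.kreweras.part v, π.kreweras.part_mem.2 (Finset.mem_univ v), ?_⟩
  intro u hu'
  rw [Finpartition.mem_part_iff_exists]
  have := (kreweras_rel π v u).2 (main' v u ⟨V, hV, hv, hu'⟩)
  obtain ⟨W, hW, h1, h2⟩ := this
  exact ⟨W, hW, h2, h1⟩

end SetPart

/-! ### Power series in non-commuting variables and the boxed convolution -/

/-- Words of length `n` over `s` letters are functions `Fin n → Fin s`. The restriction `w|V` of a
word (or of any `n`-tuple) to a subset `V` of its positions. -/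
def restrictTo {α : Type*} {n : ℕ} (w : Fin n → α) (V : Finset (Fin n)) : Fin V.card → α :=
  fun i => w (V.orderEmbOfFin rfl i)

/-- Formal power series in `s` non-commuting variables without constant term: `coeff n w` is the
coefficient of `z_w`, for `w` a word of length `n`. -/
@[ext]
structure NCSeries (s : ℕ) (R : Type u) [CommRing R] where
  coeff : ∀ n : ℕ, (Fin n → Fin s) → R
  coeff_zero : ∀ w : Fin 0 → Fin s, coeff 0 w = 0

namespace NCSeries

variable {s : ℕ} {R : Type u} [CommRing R]

/-- `X_{w,π}(f)`, the product over the blocks `V` of `π` of the coefficients `X_{w|V}(f)`. -/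
def coeffPart (f : NCSeries s R) {n : ℕ} (w : Fin n → Fin s) (π : SetPart n) : R :=
  ∏ V ∈ π.parts, f.coeff V.card (restrictTo w V)

/-- The boxed convolution `f ⊠ g`. -/
noncomputable def boxConv (f g : NCSeries s R) : NCSeries s R where
  coeff n w := if n = 0 then 0 else
    ∑ π ∈ SetPart.NC n, f.coeffPart w π * g.coeffPart w π.kreweras
  coeff_zero _ := if_pos rfl

theorem setPart_one_parts (π : SetPart 1) : π.parts = {Finset.univ} := by
  have hall : ∀ W ∈ π.parts, W = Finset.univ := by
    intro W hW
    obtain ⟨x, hx⟩ := π.nonempty_of_mem_parts hW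
    ext y
    rw [Subsingleton.elim y x]
    exact ⟨fun _ => Finset.mem_univ _, fun _ => hx⟩
  obtain ⟨V, hV, h0⟩ := π.exists_mem (Finset.mem_univ (0 : Fin 1))
  ext W
  rw [Finset.mem_singleton]
  refine ⟨hall W, fun h => ?_⟩
  have := hall V hV
  subst this
  subst h
  exact hV

theorem coeffPart_one (f : NCSeries s R) (w : Fin 1 → Fin s) (π : SetPart 1) :
    f.coeffPart w π = f.coeff 1 w := by
  rw [coeffPart, setPart_one_parts, Finset.prod_singleton]
  have : restrictTo w Finset.univ = w := by
    funext i
    exact congrArg w (Subsingleton.elim _ _)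
  exact congrArg (f.coeff 1) this

theorem boxConv_coeff_one (f g : NCSeries s R) (w : Fin 1 → Fin s) :
    (f.boxConv g).coeff 1 w = f.coeff 1 w * g.coeff 1 w := by
  have hs : ∀ π σ : SetPart 1, π = σ := fun π σ =>
    Finpartition.ext ((setPart_one_parts π).trans (setPart_one_parts σ).symm)
  have hNC : SetPart.NC 1 = {⊥} := by
    ext π
    simp only [SetPart.NC, Finset.mem_filter, Finset.mem_univ, true_and, Finset.mem_singleton]
    refine ⟨fun _ => hs _ _, fun _ p q _ _ h => ?_⟩
    exact absurd h (by rw [Subsingleton.elim p q]; exact lt_irrefl _)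
  simp only [boxConv, one_ne_zero, if_false, hNC, Finset.sum_singleton, coeffPart_one]

/-- Change of coefficients along a ring homomorphism. -/
def map {R' : Type u} [CommRing R'] (h : R →+* R') (f : NCSeries s R) : NCSeries s R' where
  coeff n w := h (f.coeff n w)
  coeff_zero w := by rw [f.coeff_zero, map_zero]

end NCSeries

/-- `𝔊ˢ(R)`: the power series without constant term whose coefficients of `z_1, …, z_s` are
units of `R`. -/
def GSeries (s : ℕ) (R : Type u) [CommRing R] : Type u :=
  {f : NCSeries s R // ∀ i : Fin s, IsUnit (f.coeff 1 fun _ => i)}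

namespace GSeries

variable {s : ℕ} {R : Type u} [CommRing R]

/-- The operation of `𝔊ˢ(R)` is the boxed convolution. -/
noncomputable instance : Mul (GSeries s R) where
  mul f g := ⟨f.1.boxConv g.1, fun i => by
    rw [NCSeries.boxConv_coeff_one]
    exact (f.2 i).mul (g.2 i)⟩

/-- Functoriality of `𝔊ˢ`. -/
def map {R' : Type u} [CommRing R'] (h : R →+* R') (f : GSeries s R) : GSeries s R' :=
  ⟨f.1.map h, fun i => (f.2 i).map h⟩

end GSeries

/-! ### Borel groups and their inverse limit -/

/-- The Borel group `𝔹_N(R)` of invertible upper-triangular matrices. -/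
def BorelGroup (N : ℕ) (R : Type u) [CommRing R] : Subgroup (GL (Fin N) R) where
  carrier := {g | ∀ i j : Fin N, j < i → (g : Matrix (Fin N) (Fin N) R) i j = 0}
  mul_mem' {g h} hg hh := by
    have : Matrix.BlockTriangular (g.1 * h.1) id :=
      Matrix.BlockTriangular.mul (fun i j hij => hg i j hij) (fun i j hij => hh i j hij)
    exact fun i j hij => this hij
  one_mem' i j hij := by simp [hij.ne']
  inv_mem' {g} hg := by
    have : Matrix.BlockTriangular (g : Matrix (Fin N) (Fin N) R)⁻¹ id := by
      have : Invertible (g : Matrix (Fin N) (Fin N) R) := g.invertible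
      exact Matrix.blockTriangular_inv_of_blockTriangular (fun i j hij => hg i j hij)
    intro i j hij
    rw [Matrix.coe_units_inv]
    exact this hij

namespace BorelGroup

variable {R : Type u} [CommRing R]

/-- The underlying matrix. -/
def mat {N : ℕ} (g : BorelGroup N R) : Matrix (Fin N) (Fin N) R := g.1.1

theorem submatrix_mul {N : ℕ} (g h : BorelGroup (N + 1) R) :
    (mat (g * h)).submatrix Fin.castSucc Fin.castSucc =
      (mat g).submatrix Fin.castSucc Fin.castSucc *
        (mat h).submatrix Fin.castSucc Fin.castSucc := by
  ext i j
  change (mat g * mat h) i.castSucc j.castSucc = _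
  rw [Matrix.mul_apply, Fin.sum_univ_castSucc, Matrix.mul_apply]
  have h0 : mat h (Fin.last N) j.castSucc = 0 := h.2 _ _ (Fin.castSucc_lt_last j)
  rw [h0, mul_zero, add_zero]
  rfl

theorem submatrix_one {N : ℕ} :
    (mat (1 : BorelGroup (N + 1) R)).submatrix Fin.castSucc Fin.castSucc = 1 :=
  Matrix.submatrix_one _ (Fin.castSucc_injective N)

/-- The transition map `𝔹_{N+1}(R) → 𝔹_N(R)`: the upper left `N × N` block. -/
def truncate (N : ℕ) : BorelGroup (N + 1) R →* BorelGroup N R where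
  toFun g := ⟨⟨(mat g).submatrix Fin.castSucc Fin.castSucc,
      (mat g⁻¹).submatrix Fin.castSucc Fin.castSucc,
      by rw [← submatrix_mul, mul_inv_cancel, submatrix_one],
      by rw [← submatrix_mul, inv_mul_cancel, submatrix_one]⟩,
    fun i j hij => g.2 _ _ (Fin.castSucc_lt_castSucc_iff.2 hij)⟩
  map_one' := Subtype.ext (Units.ext submatrix_one)
  map_mul' g h := Subtype.ext (Units.ext (submatrix_mul g h))

end BorelGroup

/-- `𝔹_∞(R)`, the inverse limit of the `𝔹_N(R)`. -/
def BorelLim (R : Type u) [CommRing R] : Subgroup (∀ N : ℕ, BorelGroup N R) where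
  carrier := {g | ∀ N, BorelGroup.truncate N (g (N + 1)) = g N}
  mul_mem' hg hh N := by
    simp only [Set.mem_ofPred_eq] at hg hh
    simp [hg N, hh N]
  one_mem' N := by simp
  inv_mem' hg N := by
    simp only [Set.mem_ofPred_eq] at hg
    simp [hg N]

/-! ### Algebraic representations of `𝔊ˢ` -/

/-- An upper-triangular representation `ρ : 𝔊ˢ → 𝔹_∞` over `k`: a morphism of group-valued functors
on commutative `k`-algebras. -/
structure TriangularRep (k : Type u) [Field k] (s : ℕ) where
  app : ∀ (R : Type u) [CommRing R] [Algebra k R], GSeries s R →ₙ* BorelLim R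
  naturality : ∀ (R R' : Type u) [CommRing R] [Algebra k R] [CommRing R'] [Algebra k R']
    (h : R →ₐ[k] R') (f : GSeries s R) (N : ℕ),
    BorelGroup.mat ((app R' (f.map h.toRingHom)).1 N) = (BorelGroup.mat ((app R f).1 N)).map h

/-- The representation is faithful: it has trivial kernel, i.e. is injective on `R`-valued points
for every commutative `k`-algebra `R`. -/
def TriangularRep.IsFaithful {k : Type u} [Field k] {s : ℕ} (ρ : TriangularRep k s) : Prop :=
  ∀ (R : Type u) [CommRing R] [Algebra k R], Function.Injective (ρ.app R)

/-- `𝔊ˢ` has a faithful (not necessarily triangular) linear representation `𝔊ˢ → GL_N` over `k` of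
finite degree `N`. -/
def HasFaithfulRepOfDegree (k : Type u) [Field k] (s N : ℕ) : Prop :=
  ∃ σ : ∀ (R : Type u) [CommRing R] [Algebra k R], GSeries s R →ₙ* GL (Fin N) R,
    (∀ (R R' : Type u) [CommRing R] [Algebra k R] [CommRing R'] [Algebra k R']
      (h : R →ₐ[k] R') (f : GSeries s R),
      (σ R' (f.map h.toRingHom) : Matrix (Fin N) (Fin N) R') =
        (σ R f : Matrix (Fin N) (Fin N) R).map h) ∧
    ∀ (R : Type u) [CommRing R] [Algebra k R], Function.Injective (σ R)

/-- A minimal faithful representation: faithful and of least possible degree. A representation into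
`𝔹_∞` has countably infinite degree, so this says that no finite degree is possible. -/
def TriangularRep.IsMinimalFaithful {k : Type u} [Field k] {s : ℕ} (ρ : TriangularRep k s) :
    Prop :=
  ρ.IsFaithful ∧ ∀ N : ℕ, ¬ HasFaithfulRepOfDegree k s N

/-! ### Free cumulants, freeness, and the transforms -/

section Probability

variable {k : Type u} [CommRing k] {A : Type v} [Ring A] [Algebra k A]
  {R : Type u} [CommRing R] [Algebra k R]

theorem card_lt_of_mem_parts {n : ℕ} {π : SetPart n} (hπ : Finset.univ ∉ π.parts)
    {V : Finset (Fin n)} (hV : V ∈ π.parts) : V.card < n := by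
  have h : V ≠ Finset.univ := fun h => hπ (h ▸ hV)
  simpa using Finset.card_lt_card (Finset.ssubset_univ_iff.2 h)

open Classical in
/-- The free cumulants `κ_n(c_1, …, c_n)` of a functional `φ : A → R`, by recursion on `n` from the
moment-cumulant formula: the term of `π = 1_n` is solved for. -/
noncomputable def freeCumulant (φ : A →ₗ[k] R) (n : ℕ) (c : Fin n → A) : R :=
  φ (List.ofFn c).prod -
    ∑ π : {π : SetPart n // π.IsNonCrossing ∧ Finset.univ ∉ π.parts},
      ∏ V : {V : Finset (Fin n) // V ∈ π.1.parts},
        freeCumulant φ V.1.card (restrictTo c V.1)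
termination_by n
decreasing_by exact card_lt_of_mem_parts π.2.2 V.2

/-- `κ_π[c_1, …, c_n]`. -/
noncomputable def freeCumulantPart (φ : A →ₗ[k] R) {n : ℕ} (c : Fin n → A) (π : SetPart n) : R :=
  ∏ V ∈ π.parts, freeCumulant φ V.card (restrictTo c V)

/-- The moment-cumulant formula. -/
theorem moment_cumulant (φ : A →ₗ[k] R) (n : ℕ) (hn : 1 ≤ n) (c : Fin n → A) :
    φ (List.ofFn c).prod = ∑ π ∈ SetPart.NC n, freeCumulantPart φ c π := by
  classical
  obtain ⟨m, rfl⟩ : ∃ m, n = m + 1 := ⟨n - 1, by omega⟩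
  have hne : (Finset.univ : Finset (Fin (m + 1))) ≠ ⊥ := Finset.univ_nonempty.ne_empty
  set T : SetPart (m + 1) := Finpartition.indiscrete hne with hT
  have hTp : T.parts = {Finset.univ} := rfl
  have huniq : ∀ π : SetPart (m + 1), Finset.univ ∈ π.parts → π = T := by
    intro π hπ
    apply Finpartition.ext
    rw [hTp]
    ext W
    rw [Finset.mem_singleton]
    refine ⟨fun hW => ?_, fun h => h ▸ hπ⟩
    obtain ⟨x, hx⟩ := π.nonempty_of_mem_parts hW
    exact π.disjoint.elim_finset hW hπ x hx (Finset.mem_univ x)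
  have hTnc : T.IsNonCrossing := by
    intro p₁ q₁ p₂ q₂ _ _ _ _ _
    exact ⟨Finset.univ, by rw [hTp]; simp, Finset.mem_univ _, Finset.mem_univ _⟩
  have hTmem : T ∈ SetPart.NC (m + 1) := by simp [SetPart.NC, hTnc]
  rw [← Finset.add_sum_erase _ _ hTmem]
  have h1 : freeCumulantPart φ c T = freeCumulant φ (m + 1) c := by
    rw [freeCumulantPart, hTp, Finset.prod_singleton]
    have gen : ∀ (j : ℕ) (hj : (Finset.univ : Finset (Fin (m + 1))).card = j) ,
        freeCumulant φ _ (restrictTo c Finset.univ) =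
          freeCumulant φ j fun i => c (Finset.univ.orderEmbOfFin hj i) := by
      intro j hj; subst hj; rfl
    rw [gen (m + 1) (by simp)]
    congr 1
    funext i
    have := Finset.orderEmbOfFin_unique (s := (Finset.univ : Finset (Fin (m + 1))))
      (k := m + 1) (by simp) (f := id) (fun x => Finset.mem_univ _) strictMono_id
    rw [← this]; rfl
  rw [h1, freeCumulant]
  have h2 : ∑ π ∈ (SetPart.NC (m + 1)).erase T, freeCumulantPart φ c π =
      ∑ π : {π : SetPart (m + 1) // π.IsNonCrossing ∧ Finset.univ ∉ π.parts},
      ∏ V : {V : Finset (Fin (m + 1)) // V ∈ π.1.parts},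
        freeCumulant φ V.1.card (restrictTo c V.1) := by
    rw [Finset.sum_subtype (p := fun π : SetPart (m + 1) =>
      π.IsNonCrossing ∧ Finset.univ ∉ π.parts)]
    · refine Finset.sum_congr rfl fun π _ => ?_
      rw [freeCumulantPart]
      exact (Finset.prod_coe_sort π.1.parts
        (fun V => freeCumulant φ V.card (restrictTo c V))).symm
    · intro π
      simp only [SetPart.NC, Finset.mem_erase, Finset.mem_filter, Finset.mem_univ, true_and]
      constructor
      · rintro ⟨h, h'⟩
        exact ⟨h', fun hu => h (huniq π hu)⟩
      · rintro ⟨h, h'⟩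
        refine ⟨fun e => h' ?_, h⟩
        rw [e, hTp]
        simp
  rw [h2]
  ring

theorem freeCumulant_one (φ : A →ₗ[k] R) (c : Fin 1 → A) : freeCumulant φ 1 c = φ (c 0) := by
  rw [freeCumulant, Finset.sum_eq_zero, sub_zero]
  · simp
  · intro π _
    exact absurd (by rw [NCSeries.setPart_one_parts]; simp) π.2.2

/-- A family of subsets of `A` is combinatorially free if all its mixed free cumulants vanish. -/
def CombinatoriallyFree {ι : Type*} (φ : A →ₗ[k] R) (M : ι → Set A) : Prop :=
  ∀ (m : ℕ) (c : Fin m → A) (i : Fin m → ι), (∀ j, c j ∈ M (i j)) →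
    (∃ p q, i p ≠ i q) → freeCumulant φ m c = 0

/-- The distribution of an `s`-tuple: the functional `z_w ↦ φ(a_w)` on non-commutative
polynomials. -/
noncomputable def distribution {s : ℕ} (φ : A →ₗ[k] R) (a : Fin s → A) :
    FreeAlgebra k (Fin s) →ₗ[k] R :=
  φ ∘ₗ (FreeAlgebra.lift k a).toLinearMap

/-- The `R`-transform: the coefficient of `z_w` is the free cumulant of `a_w`. -/
noncomputable def rTransform {s : ℕ} (φ : A →ₗ[k] R) (a : Fin s → A) : NCSeries s R where
  coeff n w := if n = 0 then 0 else freeCumulant φ n fun j => a (w j)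
  coeff_zero _ := if_pos rfl

/-- The `R`-transform of a tuple with invertible means is a point of `𝔊ˢ(R)`. -/
noncomputable def rTransformG {s : ℕ} (φ : A →ₗ[k] R) (a : Fin s → A)
    (ha : ∀ i, IsUnit (φ (a i))) : GSeries s R :=
  ⟨rTransform φ a, fun i => by
    simpa [rTransform, freeCumulant_one] using ha i⟩

end Probability

/-- The `S`-transform `S(a) = ρ(R(a))` attached to the representation `ρ`. -/
noncomputable def sTransform {k : Type u} [Field k] {s : ℕ} (ρ : TriangularRep k s)
    {A : Type v} [Ring A] [Algebra k A] (φ : A →ₗ[k] k) (a : Fin s → A)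
    (ha : ∀ i, IsUnit (φ (a i))) : BorelLim k :=
  ρ.app k (rTransformG φ a ha)

/-!
Everything rests on two properties of the Kreweras complement `K` on the lattice `NC(n)`, which are
proved from its description by saturated intervals: `K` reflects the order
(`SetPart.le_of_kreweras_le`), and for `ρ ≤ π` one has `K(π) = K(ρ) ⊓ K(π ⊓ K(ρ))`
(`SetPart.kreweras_eq_inf`). Here `π ⊓ K(ρ)` is the Kreweras complement of `ρ` relative to `π`: on
each block of `π` it is the complement of the restriction of `ρ`
(`SetPart.comap_blockEmb_kreweras`). By counting, `τ ↦ τ ⊓ K(π)` is therefore a bijection from the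
interval `[π, σ]` onto the non-crossing refinements of `σ ⊓ K(π)` (`SetPart.sum_interval_eq`).

Consequently `(π, σ) ↦ f_{w, σ ⊓ K(π)}`, for `π ≤ σ` in `NC(|w|)`, turns boxed convolution into
the product of the incidence algebra of `NC(|w|)` (`sum_interval_partProd`). The direct sum of these
matrices over all words `w`, with a basis enumerated compatibly with the order, is an
upper-triangular representation. Its diagonal entries are products of the units `f_i`, and its entry
at `(0_n, 1_n)` for the word `w` is `f_w`, so it is faithful (`incidenceRep_isFaithful`). No
representation of finite degree is faithful, because its entries at a generic series are polynomials
in finitely many coefficients (`not_hasFaithfulRepOfDegree`).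

The same identity gives associativity of boxed convolution (`conv_assoc`). For free tuples `a` and
`b`, the moment-cumulant formula applied to the alternating word `a b a b ⋯` expresses the moments
of `a ⋆ b` by the pairs `π`, `σ ≤ K(π)`, that is, as `R(a) ⊠ (R(b) ⊠ 1)`, where `1` is the family
with all coefficients equal to `1`. These moments are also `R(a ⋆ b) ⊠ 1`, and `⊠ 1` can be
cancelled after re-bracketing; hence `R(a ⋆ b) = R(a) ⊠ R(b)` (`rTransform_mul`). Since cumulants
and moments determine each other (`rTransform_eq_iff`), the statements on the `S`-transform follow
for every faithful representation.
-/

/-! ### Partitions as equivalence relations -/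

namespace SetPart

theorem rel_refl {n : ℕ} (π : SetPart n) (p : Fin n) : π.Rel p p := by
  obtain ⟨V, hV, h⟩ := π.exists_mem (Finset.mem_univ p)
  exact ⟨V, hV, h, h⟩

theorem rel_iff_of_mem {n : ℕ} {π : SetPart n} {V : Finset (Fin n)} (hV : V ∈ π.parts)
    {p q : Fin n} (hp : p ∈ V) : π.Rel p q ↔ q ∈ V := by
  refine ⟨?_, fun hq => ⟨V, hV, hp, hq⟩⟩
  rintro ⟨W, hW, h1, h2⟩
  exact π.disjoint.elim_finset hW hV p h1 hp ▸ h2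

theorem le_iff_rel {n : ℕ} {π σ : SetPart n} :
    π ≤ σ ↔ ∀ p q, π.Rel p q → σ.Rel p q := by
  constructor
  · rintro h p q ⟨V, hV, hp, hq⟩
    obtain ⟨W, hW, hVW⟩ := h hV
    exact ⟨W, hW, hVW hp, hVW hq⟩
  · intro h V hV
    obtain ⟨p, hp⟩ := π.nonempty_of_mem_parts hV
    obtain ⟨W, hW, hpW⟩ := σ.exists_mem (Finset.mem_univ p)
    exact ⟨W, hW, fun q hq => (rel_iff_of_mem hW hpW).1 (h p q ⟨V, hV, hp, hq⟩)⟩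

theorem ext_rel {n : ℕ} {π σ : SetPart n} (h : ∀ p q, π.Rel p q ↔ σ.Rel p q) : π = σ :=
  le_antisymm (le_iff_rel.2 fun p q => (h p q).1) (le_iff_rel.2 fun p q => (h p q).2)

theorem inf_rel {n : ℕ} {π σ : SetPart n} {p q : Fin n} :
    (π ⊓ σ).Rel p q ↔ π.Rel p q ∧ σ.Rel p q := by
  constructor
  · exact fun h => ⟨le_iff_rel.1 inf_le_left p q h, le_iff_rel.1 inf_le_right p q h⟩
  · rintro ⟨⟨V, hV, h1, h2⟩, ⟨W, hW, h3, h4⟩⟩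
    refine ⟨V ∩ W, ?_, Finset.mem_inter.2 ⟨h1, h3⟩, Finset.mem_inter.2 ⟨h2, h4⟩⟩
    rw [Finpartition.parts_inf, Finset.mem_erase]
    refine ⟨Finset.ne_empty_of_mem (Finset.mem_inter.2 ⟨h1, h3⟩), ?_⟩
    exact Finset.mem_image.2 ⟨(V, W), Finset.mem_product.2 ⟨hV, hW⟩, rfl⟩

/-- A nonempty set `V` is a block as soon as it is the class of one of its elements. -/
theorem mem_parts_of_rel {n : ℕ} {π : SetPart n} {V : Finset (Fin n)} {p : Fin n}
    (h : ∀ q, π.Rel p q ↔ q ∈ V) : V ∈ π.parts := by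
  obtain ⟨W, hW, hp⟩ := π.exists_mem (Finset.mem_univ p)
  have : V = W := by
    ext q
    rw [← h, rel_iff_of_mem hW hp]
  exact this ▸ hW

open Classical in
/-- The partition of `[n]` into the classes of an equivalence relation. -/
noncomputable def ofSetoid {n : ℕ} (r : Setoid (Fin n)) : SetPart n :=
  Finpartition.ofSetoid r

theorem ofSetoid_rel {n : ℕ} (r : Setoid (Fin n)) (p q : Fin n) :
    (ofSetoid r).Rel p q ↔ r p q := by
  classical
  rw [← Finpartition.mem_part_ofSetoid_iff_rel (s := r)]
  unfold Rel ofSetoid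
  rw [Finpartition.mem_part_iff_exists]
  constructor
  · rintro ⟨V, hV, h1, h2⟩
    exact ⟨V, by convert hV, h2, h1⟩
  · rintro ⟨V, hV, h1, h2⟩
    exact ⟨V, by convert hV, h2, h1⟩

/-- The pull-back of a partition along a map; for an order embedding with image `V` this is the
restriction of the partition to `V`, with `V` relabelled increasingly. -/
noncomputable def comap {m n : ℕ} (e : Fin m → Fin n) (π : SetPart n) : SetPart m :=
  ofSetoid
    { r := fun x y => π.Rel (e x) (e y)
      iseqv := ⟨fun _ => rel_refl _ _, rel_symm, rel_trans⟩ }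

@[simp] theorem comap_rel {m n : ℕ} {e : Fin m → Fin n} {π : SetPart n} {x y : Fin m} :
    (comap e π).Rel x y ↔ π.Rel (e x) (e y) :=
  ofSetoid_rel _ _ _

theorem mem_NC {n : ℕ} {π : SetPart n} : π ∈ NC n ↔ π.IsNonCrossing := by
  classical
  simp [NC]

theorem IsNonCrossing.comap {m n : ℕ} {π : SetPart n} (hπ : π.IsNonCrossing) {e : Fin m → Fin n}
    (he : StrictMono e) : (π.comap e).IsNonCrossing := by
  intro p q p' q' h1 h2 h3 h4 h5
  rw [comap_rel] at *
  exact hπ _ _ _ _ (he h1) (he h2) (he h3) h4 h5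

theorem IsNonCrossing.inf {n : ℕ} {π σ : SetPart n} (hπ : π.IsNonCrossing)
    (hσ : σ.IsNonCrossing) : (π ⊓ σ).IsNonCrossing := by
  intro p q p' q' h1 h2 h3 h4 h5
  rw [inf_rel] at *
  exact ⟨hπ _ _ _ _ h1 h2 h3 h4.1 h5.1, hσ _ _ _ _ h1 h2 h3 h4.2 h5.2⟩

theorem IsNonCrossing.kreweras {n : ℕ} {π : SetPart n} (hπ : π.IsNonCrossing) :
    π.kreweras.IsNonCrossing :=
  (kreweras_isGreatest π hπ).1.1

/-! ### Order properties of the Kreweras complement -/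

/-- For `i ≤ j`, the points `i` and `j` lie in one block of `K(π)` iff `(i, j]` is saturated
for `π`. -/
theorem kreweras_rel_of_le {n : ℕ} {π : SetPart n} {i j : Fin n} (hij : i ≤ j) :
    π.kreweras.Rel i j ↔ ∀ p q, π.Rel p q → i < p → p ≤ j → i < q ∧ q ≤ j := by
  rw [kreweras_rel]
  change (∀ p q, π.Rel p q → ((p ≤ i ↔ p ≤ j) ↔ (q ≤ i ↔ q ≤ j))) ↔ _
  constructor
  · intro h p q hpq h1 h2
    have := h p q hpq
    grind
  · intro h p q hpq
    have h1 := h p q hpq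
    have h2 := h q p (rel_symm hpq)
    grind

/-- A block of a non-crossing partition which meets the interval between two points of another
block lies in it. -/
theorem IsNonCrossing.between {n : ℕ} {π : SetPart n} (hπ : π.IsNonCrossing) {v v' p q : Fin n}
    (hv : π.Rel v v') (hpq : π.Rel p q) (hp : ¬ π.Rel v p) (h1 : v < p) (h2 : p < v') :
    v < q ∧ q < v' := by
  have hvq : ¬ π.Rel v q := fun h => hp (rel_trans h (rel_symm hpq))
  have h3 : q ≠ v := fun h => hvq (h ▸ rel_refl π q)
  have h4 : q ≠ v' := fun h => hvq (h ▸ hv)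
  by_contra hcon
  rcases lt_or_ge q v with h | h
  · have := hπ q v p v' h h1 h2 (rel_symm hpq) hv
    exact hp (rel_symm this)
  · have h5 : v' < q := by
      rcases lt_trichotomy q v' with h6 | h6 | h6
      · exact absurd ⟨lt_of_le_of_ne h h3.symm, h6⟩ hcon
      · exact absurd h6 h4
      · exact h6
    have := hπ v p v' q h1 h2 h5 hv hpq
    exact hp (rel_trans hv this)

theorem kreweras_anti {n : ℕ} {π σ : SetPart n} (h : π ≤ σ) : σ.kreweras ≤ π.kreweras := by
  rw [le_iff_rel] at *
  intro i j hij
  rw [kreweras_rel] at *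
  exact fun p q hpq => hij p q (h p q hpq)

/-- Two points which lie in different blocks of a non-crossing partition are separated by an
interval which is a union of blocks. -/
theorem IsNonCrossing.exists_separating {n : ℕ} {π : SetPart n} (hπ : π.IsNonCrossing)
    {p q : Fin n} (hpq : p < q) (h : ¬ π.Rel p q) :
    ∃ i j, π.kreweras.Rel i j ∧ ¬ ((p ≤ i ↔ p ≤ j) ↔ (q ≤ i ↔ q ≤ j)) := by
  classical
  let V := Finset.univ.filter fun x => π.Rel p x
  have mV : ∀ x, x ∈ V ↔ π.Rel p x := fun x => by simp [V]
  have hpV : p ∈ V := (mV p).2 (rel_refl π p)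
  have hl : (V.filter (· < q)).Nonempty := ⟨p, by simp [hpV, hpq]⟩
  obtain ⟨v, hv, hvmax⟩ := (V.filter (· < q)).exists_max_image id hl
  simp only [Finset.mem_filter, id, mV] at hv hvmax
  by_cases hr : (V.filter (q < ·)).Nonempty
  · -- the block of `p` has points on both sides of `q`: take the gap around `q`
    obtain ⟨v', hv', hvmin⟩ := (V.filter (q < ·)).exists_min_image id hr
    simp only [Finset.mem_filter, id, mV] at hv' hvmin
    have hlt : v < v' := hv.2.trans hv'.2
    let j : Fin n := ⟨v'.1 - 1, by omega⟩
    have hgap : ∀ x, v < x → x < v' → ¬ π.Rel p x := by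
      intro x h1 h2 h3
      rcases lt_trichotomy x q with h4 | h4 | h4
      · exact absurd (hvmax x ⟨h3, h4⟩) (not_le.2 h1)
      · exact h (h4 ▸ h3)
      · exact absurd (hvmin x ⟨h3, h4⟩) (not_le.2 h2)
    have hj : ∀ x : Fin n, x ≤ j ↔ x < v' := by
      intro x
      simp only [Fin.le_def, Fin.lt_def, j] at *
      omega
    refine ⟨v, j, ?_, ?_⟩
    · rw [kreweras_rel_of_le ((hj v).2 hlt)]
      intro x y hxy h1 h2
      rw [hj] at h2 ⊢
      refine hπ.between (rel_trans (rel_symm hv.1) hv'.1) hxy ?_ h1 h2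
      exact fun h3 => hgap x h1 h2 (rel_trans hv.1 h3)
    · have := hvmax p ⟨rel_refl π p, hpq⟩
      rw [hj, hj]
      grind
  · -- the block of `p` lies to the left of `q`: take its convex hull, or what lies right of it
    have hV : ∀ x, π.Rel p x → x ≤ v := by
      intro x hx
      rcases lt_trichotomy x q with h4 | h4 | h4
      · exact hvmax x ⟨hx, h4⟩
      · exact absurd (h4 ▸ hx) h
      · exact absurd ⟨x, by simp [mV, hx, h4]⟩ hr
    obtain ⟨u, hu, humin⟩ := V.exists_min_image id ⟨p, hpV⟩
    simp only [id, mV] at hu humin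
    have hhull : ∀ x y, π.Rel x y → u ≤ x → x ≤ v → u ≤ y ∧ y ≤ v := by
      intro x y hxy h1 h2
      by_cases hx : π.Rel p x
      · exact ⟨humin y (rel_trans hx hxy), hV y (rel_trans hx hxy)⟩
      · have h1' : u < x := lt_of_le_of_ne h1 fun e => hx (e ▸ hu)
        have h2' : x < v := lt_of_le_of_ne h2 fun e => hx (e ▸ hv.1)
        have := hπ.between (rel_trans (rel_symm hu) hv.1) hxy
          (fun h3 => hx (rel_trans hu h3)) h1' h2'
        exact ⟨this.1.le, this.2.le⟩
    have hup := humin p (rel_refl π p)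
    have hpv := hV p (rel_refl π p)
    -- the half-open interval `(u - 1, v]` exists only for `u > 0`
    rcases Nat.eq_zero_or_pos u.1 with hu0 | hu0
    · have hu' : ∀ x : Fin n, u ≤ x := fun x => by rw [Fin.le_def]; omega
      let j : Fin n := ⟨n - 1, by omega⟩
      have hj : ∀ x : Fin n, x ≤ j := fun x => by simp only [Fin.le_def, j]; omega
      refine ⟨v, j, ?_, ?_⟩
      · rw [kreweras_rel_of_le (hj v)]
        intro x y hxy h1 _
        refine ⟨?_, hj y⟩
        by_contra h2
        exact absurd (hhull y x (rel_symm hxy) (hu' y) (not_lt.1 h2)).2 (not_le.2 h1)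
      · have := hj p
        have := hj q
        grind
    · let i : Fin n := ⟨u.1 - 1, by omega⟩
      have hi : ∀ x : Fin n, i < x ↔ u ≤ x := by
        intro x
        simp only [Fin.le_def, Fin.lt_def, i] at *
        omega
      refine ⟨i, v, ?_, ?_⟩
      · rw [kreweras_rel_of_le (((hi v).2 (hup.trans hpv)).le)]
        intro x y hxy h1 h2
        rw [hi] at h1 ⊢
        exact hhull x y hxy h1 h2
      · have h1 := (hi p).2 hup
        have h2 := (hi q).2 (hup.trans hpq.le)
        grind

/-- The Kreweras complement reflects the order: a partition can be recovered from its complement,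
whose pairs are the intervals that separate its blocks. -/
theorem le_of_kreweras_le {n : ℕ} {π σ : SetPart n} (hσ : σ.IsNonCrossing)
    (h : σ.kreweras ≤ π.kreweras) : π ≤ σ := by
  have key : ∀ p q, p < q → π.Rel p q → σ.Rel p q := by
    intro p q hpq hr
    by_contra hcon
    obtain ⟨i, j, hij, hsep⟩ := hσ.exists_separating hpq hcon
    have := le_iff_rel.1 h i j hij
    rw [kreweras_rel] at this
    exact hsep (this p q hr)
  rw [le_iff_rel]
  intro p q hr
  rcases lt_trichotomy p q with h1 | h1 | h1
  · exact key p q h1 hr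
  · exact h1 ▸ rel_refl σ p
  · exact rel_symm (key q p h1 (rel_symm hr))

theorem kreweras_injOn {n : ℕ} : Set.InjOn (kreweras (n := n)) (NC n : Set (SetPart n)) := by
  intro π hπ σ hσ h
  exact le_antisymm (le_of_kreweras_le (mem_NC.1 hσ) h.ge) (le_of_kreweras_le (mem_NC.1 hπ) h.le)

/-- The Kreweras complement relative to `ρ ≤ π` determines `K(π)`: an interval saturated for `ρ`
which cuts a block `V` of `π` yields a pair of points of `V` which `K(ρ)` identifies and which the
interval separates. -/
theorem kreweras_eq_inf {n : ℕ} {π ρ : SetPart n} (hπ : π.IsNonCrossing) (h : ρ ≤ π) :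
    π.kreweras = ρ.kreweras ⊓ (π ⊓ ρ.kreweras).kreweras := by
  classical
  refine le_antisymm (le_inf (kreweras_anti h) (kreweras_anti inf_le_left)) ?_
  have hρπ := le_iff_rel.1 h
  have key : ∀ i j, i ≤ j → ρ.kreweras.Rel i j → (π ⊓ ρ.kreweras).kreweras.Rel i j →
      π.kreweras.Rel i j := by
    intro i j hij h1 h2
    rw [kreweras_rel_of_le hij] at h1 h2 ⊢
    intro p q hpq hp1 hp2
    let V := Finset.univ.filter fun x => π.Rel p x
    have mV : ∀ x, x ∈ V ↔ π.Rel p x := fun x => by simp [V]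
    obtain ⟨p', hp', hmax⟩ := (V.filter fun x => i < x ∧ x ≤ j).exists_max_image id
      ⟨p, by simp [mV, rel_refl, hp1, hp2]⟩
    simp only [Finset.mem_filter, id, mV] at hp' hmax
    obtain ⟨hp'V, hip', hp'j⟩ := hp'
    by_contra hq
    -- `V ∩ (i, j]` is cut out of `V` by the interval from the last point `q'` of `V` before it to
    -- its own last point `p'`; without such a `q'`, its complement in `V` is cut out by `(p', q']`,
    -- where now `q' = max V`
    by_cases hl : (V.filter fun x => x ≤ i).Nonempty
    · obtain ⟨q', hq', hqmax⟩ := (V.filter fun x => x ≤ i).exists_max_image id hl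
      simp only [Finset.mem_filter, id, mV] at hq' hqmax
      have hrel : (π ⊓ ρ.kreweras).Rel q' p' := by
        rw [inf_rel, kreweras_rel_of_le (hq'.2.trans hip'.le)]
        refine ⟨rel_trans (rel_symm hq'.1) hp'V, ?_⟩
        intro x y hxy hx1 hx2
        by_cases hx : π.Rel p x
        · have hy := rel_trans hx (hρπ x y hxy)
          have hix : i < x := by
            by_contra hcon
            exact absurd (hqmax x ⟨hx, not_lt.1 hcon⟩) (not_le.2 hx1)
          have := h1 x y hxy hix (hx2.trans hp'j)
          exact ⟨hq'.2.trans_lt this.1, hmax y ⟨hy, this⟩⟩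
        · have := hπ.between (rel_trans (rel_symm hq'.1) hp'V) (hρπ x y hxy)
            (fun h3 => hx (rel_trans hq'.1 h3)) hx1
            (lt_of_le_of_ne hx2 fun e => hx (e ▸ hp'V))
          exact ⟨this.1, this.2.le⟩
      have := h2 p' q' (rel_symm hrel) hip' hp'j
      exact absurd this.1 (not_lt.2 hq'.2)
    · have hV : ∀ x, π.Rel p x → i < x := by
        intro x hx
        by_contra hcon
        exact hl ⟨x, by simp [mV, hx, not_lt.1 hcon]⟩
      have hjq : j < q := by
        by_contra hcon
        exact hq ⟨hV q hpq, not_lt.1 hcon⟩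
      obtain ⟨q', hq', hqmax⟩ := V.exists_max_image id ⟨q, (mV q).2 hpq⟩
      simp only [id, mV] at hq' hqmax
      have hjq' : j < q' := hjq.trans_le (hqmax q hpq)
      have hrel : (π ⊓ ρ.kreweras).Rel p' q' := by
        rw [inf_rel, kreweras_rel_of_le (hp'j.trans hjq'.le)]
        refine ⟨rel_trans (rel_symm hp'V) hq', ?_⟩
        intro x y hxy hx1 hx2
        by_cases hx : π.Rel p x
        · have hy := rel_trans hx (hρπ x y hxy)
          have hjx : j < x := by
            by_contra hcon
            exact absurd (hmax x ⟨hx, hV x hx, not_lt.1 hcon⟩) (not_le.2 hx1)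
          have hjy : j < y := by
            by_contra hcon
            exact absurd (h1 y x (rel_symm hxy) (hV y hy) (not_lt.1 hcon)).2 (not_le.2 hjx)
          exact ⟨hp'j.trans_lt hjy, hqmax y hy⟩
        · have := hπ.between (rel_trans (rel_symm hp'V) hq') (hρπ x y hxy)
            (fun h3 => hx (rel_trans hp'V h3)) hx1
            (lt_of_le_of_ne hx2 fun e => hx (e ▸ hq'))
          exact ⟨this.1, this.2.le⟩
      have := h2 p' q' hrel hip' hp'j
      exact absurd this.2 (not_le.2 hjq')
  rw [le_iff_rel]
  intro i j hij
  rw [inf_rel] at hij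
  rcases le_total i j with h1 | h1
  · exact key i j h1 hij.1 hij.2
  · exact rel_symm (key j i h1 (rel_symm hij.1) (rel_symm hij.2))

open Classical in
/-- `τ ↦ τ ⊓ K(π)` is a bijection from the interval `[π, σ]` of `NC(n)` onto the non-crossing
refinements of `σ ⊓ K(π)`. It is injective because `τ ⊓ K(π)` determines `K(τ)`, and for `σ = 1`
both sides have equally many elements because `K` is an order-reversing bijection. -/
theorem sum_interval_eq {n : ℕ} {M : Type*} [AddCommMonoid M] {π σ : SetPart n}
    (hπ : π.IsNonCrossing) (hσ : σ.IsNonCrossing) (hπσ : π ≤ σ) (F : SetPart n → M) :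
    ∑ τ ∈ NC n with π ≤ τ ∧ τ ≤ σ, F (τ ⊓ π.kreweras) =
      ∑ ρ ∈ NC n with ρ ≤ σ ⊓ π.kreweras, F ρ := by
  have hmaps : Set.MapsTo (kreweras (n := n)) (NC n : Set (SetPart n)) (NC n) :=
    fun τ hτ => mem_NC.2 (mem_NC.1 hτ).kreweras
  -- `K` is injective on the finite set `NC(n)`, hence onto
  have hsurj : Set.SurjOn (kreweras (n := n)) (NC n : Set (SetPart n)) (NC n) :=
    Finset.surjOn_of_injOn_of_card_le _ hmaps kreweras_injOn le_rfl
  let A := (NC n).filter fun τ => π ≤ τ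
  let B := (NC n).filter fun ρ => ρ ≤ π.kreweras
  have hA : ∀ τ, τ ∈ A ↔ τ.IsNonCrossing ∧ π ≤ τ := fun τ => by simp [A, mem_NC]
  have hB : ∀ τ, τ ∈ B ↔ τ.IsNonCrossing ∧ τ ≤ π.kreweras := fun τ => by simp [B, mem_NC]
  have hcard : B.card ≤ A.card := by
    refine Finset.card_le_card_of_surjOn kreweras ?_
    intro ρ hρ
    have hρ' := (hB ρ).1 hρ
    obtain ⟨τ, hτ, rfl⟩ := hsurj (mem_NC.2 hρ'.1)
    exact ⟨τ, (hA τ).2 ⟨mem_NC.1 hτ, le_of_kreweras_le (mem_NC.1 hτ) hρ'.2⟩, rfl⟩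
  have hreflect : ∀ τ τ', τ ∈ A → τ' ∈ A → τ ⊓ π.kreweras ≤ τ' ⊓ π.kreweras → τ ≤ τ' := by
    intro τ τ' hτ hτ' hle
    refine le_of_kreweras_le ((hA τ').1 hτ').1 ?_
    rw [kreweras_eq_inf ((hA τ).1 hτ).1 ((hA τ).1 hτ).2,
      kreweras_eq_inf ((hA τ').1 hτ').1 ((hA τ').1 hτ').2]
    exact inf_le_inf_left _ (kreweras_anti hle)
  have hmapsΦ : Set.MapsTo (fun τ => τ ⊓ π.kreweras) (A : Set (SetPart n)) B := fun τ hτ =>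
    (hB _).2 ⟨((hA τ).1 hτ).1.inf hπ.kreweras, inf_le_right⟩
  have hinjΦ : Set.InjOn (fun τ => τ ⊓ π.kreweras) (A : Set (SetPart n)) := fun τ hτ τ' hτ' e =>
    le_antisymm (hreflect τ τ' hτ hτ' e.le) (hreflect τ' τ hτ' hτ e.ge)
  have hsurjΦ := Finset.surjOn_of_injOn_of_card_le _ hmapsΦ hinjΦ hcard
  refine Finset.sum_bij (fun τ _ => τ ⊓ π.kreweras) ?_ ?_ ?_ fun _ _ => rfl
  · intro τ hτ
    simp only [Finset.mem_filter, mem_NC] at hτ ⊢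
    exact ⟨hτ.1.inf hπ.kreweras, inf_le_inf_right _ hτ.2.2⟩
  · intro τ hτ τ' hτ' e
    simp only [Finset.mem_filter, mem_NC] at hτ hτ'
    exact hinjΦ ((hA τ).2 ⟨hτ.1, hτ.2.1⟩) ((hA τ').2 ⟨hτ'.1, hτ'.2.1⟩) e
  · intro ρ hρ
    simp only [Finset.mem_filter, mem_NC] at hρ
    obtain ⟨τ, hτ, rfl⟩ := hsurjΦ ((hB ρ).2 ⟨hρ.1, hρ.2.trans inf_le_right⟩)
    have hτ' := (hA τ).1 hτ
    refine ⟨τ, ?_, rfl⟩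
    simp only [Finset.mem_filter, mem_NC]
    exact ⟨hτ'.1, hτ'.2, hreflect τ σ hτ ((hA σ).2 ⟨hσ, hπσ⟩) hρ.2⟩

end SetPart

namespace SetPart

/-! ### Glueing partitions -/

section Glueing

variable {n : ℕ} {ι : Type*} {m : ι → ℕ} {e : ∀ i, Fin (m i) ↪o Fin n}

theorem map_mem_parts {ρ : SetPart n} (he : ∀ p, ∃ i x, e i x = p)
    (hρ : ∀ i j x y, ρ.Rel (e i x) (e j y) → i = j) {i : ι} {T : Finset (Fin (m i))}
    (hT : T ∈ (ρ.comap (e i)).parts) : T.map (e i).toEmbedding ∈ ρ.parts := by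
  obtain ⟨x, hx⟩ := (ρ.comap (e i)).nonempty_of_mem_parts hT
  refine mem_parts_of_rel (p := e i x) fun q => ?_
  obtain ⟨j, y, rfl⟩ := he q
  constructor
  · intro h
    obtain rfl := hρ _ _ _ _ h
    exact Finset.mem_map_of_mem _ ((rel_iff_of_mem hT hx).1 (comap_rel.2 h))
  · intro h
    obtain ⟨z, hz, hzy⟩ := Finset.mem_map.1 h
    change e i z = e j y at hzy
    rw [← hzy, ← comap_rel]
    exact ⟨T, hT, hx, hz⟩

/-- If `[n]` is the disjoint union of the images of the order embeddings `e i`, and every block of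
`ρ` lies in one of these images, then the blocks of `ρ` are the images of the blocks of its
restrictions. -/
theorem prod_parts_eq_prod_comap {R : Type*} [CommMonoid R] [Fintype ι] {ρ : SetPart n}
    (he : ∀ p, ∃ i x, e i x = p) (hρ : ∀ i j x y, ρ.Rel (e i x) (e j y) → i = j)
    (Φ : Finset (Fin n) → R) :
    ∏ U ∈ ρ.parts, Φ U =
      ∏ i, ∏ T ∈ (ρ.comap (e i)).parts, Φ (T.map (e i).toEmbedding) := by
  classical
  rw [Finset.prod_sigma']
  symm
  refine Finset.prod_bij (fun a _ => a.2.map (e a.1).toEmbedding) ?_ ?_ ?_ fun _ _ => rfl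
  · rintro ⟨i, T⟩ h
    exact map_mem_parts he hρ (Finset.mem_sigma.1 h).2
  · rintro ⟨i, T⟩ h ⟨j, T'⟩ h' heq
    have hT := (Finset.mem_sigma.1 h).2
    obtain ⟨x, hx⟩ := (ρ.comap (e i)).nonempty_of_mem_parts hT
    have hx' : e i x ∈ T.map (e i).toEmbedding := Finset.mem_map_of_mem _ hx
    obtain ⟨y, -, hy⟩ := Finset.mem_map.1 (heq ▸ hx')
    obtain rfl := hρ j i y x (by change e j y = e i x at hy; rw [hy]; exact rel_refl _ _)
    exact congrArg (Sigma.mk _) (Finset.map_injective _ heq)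
  · intro U hU
    obtain ⟨p, hp⟩ := ρ.nonempty_of_mem_parts hU
    obtain ⟨i, x, rfl⟩ := he p
    have hT : (Finset.univ.filter fun y => e i y ∈ U) ∈ (ρ.comap (e i)).parts :=
      mem_parts_of_rel (p := x) fun y => by simp [rel_iff_of_mem hU hp]
    refine ⟨⟨i, _⟩, Finset.mem_sigma.2 ⟨Finset.mem_univ i, hT⟩, ?_⟩
    exact ρ.disjoint.elim_finset (map_mem_parts he hρ hT) hU (e i x)
      (Finset.mem_map_of_mem _ (by simp [hp])) hp

/-- Partitions of the pieces glue to a partition of `[n]`. -/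
theorem exists_glue (he : ∀ p, ∃ i x, e i x = p) (hd : ∀ i j x y, e i x = e j y → i = j)
    (τ : ∀ i, SetPart (m i)) :
    ∃ ρ : SetPart n, (∀ i j x y, ρ.Rel (e i x) (e j y) → i = j) ∧ ∀ i, ρ.comap (e i) = τ i := by
  let r : Setoid (Fin n) :=
    { r := fun p q => ∃ i x y, e i x = p ∧ e i y = q ∧ (τ i).Rel x y
      iseqv :=
        { refl := fun p => by
            obtain ⟨i, x, hx⟩ := he p
            exact ⟨i, x, x, hx, hx, rel_refl _ _⟩
          symm := fun ⟨i, x, y, h1, h2, h3⟩ => ⟨i, y, x, h2, h1, rel_symm h3⟩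
          trans := by
            rintro _ _ _ ⟨i, x, y, rfl, rfl, h⟩ ⟨j, x', y', h1, rfl, h'⟩
            obtain rfl := hd _ _ _ _ h1
            obtain rfl := (e _).injective h1
            exact ⟨_, _, _, rfl, rfl, rel_trans h h'⟩ } }
  have hr : ∀ p q, (ofSetoid r).Rel p q ↔ ∃ i x y, e i x = p ∧ e i y = q ∧ (τ i).Rel x y :=
    ofSetoid_rel r
  refine ⟨ofSetoid r, ?_, fun i => ext_rel fun x y => ?_⟩
  · intro i j x y h
    obtain ⟨k, a, b, h1, h2, -⟩ := (hr _ _).1 h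
    exact (hd _ _ _ _ h1).symm.trans (hd _ _ _ _ h2)
  · rw [comap_rel, hr]
    constructor
    · rintro ⟨j, a, b, h1, h2, h3⟩
      obtain rfl := hd _ _ _ _ h1
      rwa [← (e _).injective h1, ← (e _).injective h2]
    · exact fun h => ⟨i, x, y, rfl, rfl, h⟩

theorem ext_comap {ρ ρ' : SetPart n} (he : ∀ p, ∃ i x, e i x = p)
    (hρ : ∀ i j x y, ρ.Rel (e i x) (e j y) → i = j)
    (hρ' : ∀ i j x y, ρ'.Rel (e i x) (e j y) → i = j)
    (h : ∀ i, ρ.comap (e i) = ρ'.comap (e i)) : ρ = ρ' := by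
  refine ext_rel fun p q => ?_
  obtain ⟨i, x, rfl⟩ := he p
  obtain ⟨j, y, rfl⟩ := he q
  constructor
  · intro hr
    obtain rfl := hρ _ _ _ _ hr
    rwa [← comap_rel, h, comap_rel] at hr
  · intro hr
    obtain rfl := hρ' _ _ _ _ hr
    rwa [← comap_rel, ← h, comap_rel] at hr

end Glueing

/-! ### Restriction of refinements to the blocks of a partition -/

section Blocks

variable {n : ℕ}

/-- The increasing enumeration of a block. -/
def blockEmb (π : SetPart n) (V : {V // V ∈ π.parts}) : Fin V.1.card ↪o Fin n :=
  V.1.orderEmbOfFin rfl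

theorem blockEmb_mem (π : SetPart n) (V : {V // V ∈ π.parts}) (x : Fin V.1.card) :
    π.blockEmb V x ∈ V.1 :=
  Finset.orderEmbOfFin_mem _ _ _

theorem exists_blockEmb_of_mem (π : SetPart n) (V : {V // V ∈ π.parts}) {p : Fin n}
    (hp : p ∈ V.1) : ∃ x, π.blockEmb V x = p := by
  have : p ∈ Set.range (V.1.orderEmbOfFin rfl) := by
    rw [Finset.range_orderEmbOfFin]
    exact hp
  exact this

theorem exists_blockEmb (π : SetPart n) (p : Fin n) : ∃ V x, π.blockEmb V x = p := by
  obtain ⟨V, hV, hp⟩ := π.exists_mem (Finset.mem_univ p)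
  exact ⟨⟨V, hV⟩, π.exists_blockEmb_of_mem ⟨V, hV⟩ hp⟩

theorem blockEmb_rel (π : SetPart n) {V W : {V // V ∈ π.parts}} {x : Fin V.1.card}
    {y : Fin W.1.card} : π.Rel (π.blockEmb V x) (π.blockEmb W y) ↔ V = W := by
  rw [rel_iff_of_mem V.2 (π.blockEmb_mem V x)]
  constructor
  · exact fun h => Subtype.ext
      (π.disjoint.elim_finset V.2 W.2 _ h (π.blockEmb_mem W y))
  · rintro rfl
    exact π.blockEmb_mem V y

theorem le_iff_blockEmb {π ρ : SetPart n} :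
    ρ ≤ π ↔ ∀ V W x y, ρ.Rel (π.blockEmb V x) (π.blockEmb W y) → V = W := by
  rw [le_iff_rel]
  constructor
  · exact fun h V W x y hr => π.blockEmb_rel.1 (h _ _ hr)
  · intro h p q hr
    obtain ⟨V, x, rfl⟩ := π.exists_blockEmb p
    obtain ⟨W, y, rfl⟩ := π.exists_blockEmb q
    exact π.blockEmb_rel.2 (h _ _ _ _ hr)

/-- Two crossing blocks of `ρ` would lie in one block of `π`, because `π` is non-crossing. -/
theorem IsNonCrossing.of_comap_blockEmb {π ρ : SetPart n} (hπ : π.IsNonCrossing) (h : ρ ≤ π)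
    (hρ : ∀ V, (ρ.comap (π.blockEmb V)).IsNonCrossing) : ρ.IsNonCrossing := by
  intro p q p' q' h1 h2 h3 h4 h5
  have h6 := le_iff_rel.1 h _ _ h4
  have h7 := le_iff_rel.1 h _ _ h5
  have h8 := hπ p q p' q' h1 h2 h3 h6 h7
  obtain ⟨V, x, rfl⟩ := π.exists_blockEmb p
  have hmem : ∀ r, π.Rel (π.blockEmb V x) r → ∃ z, π.blockEmb V z = r := fun r hr =>
    π.exists_blockEmb_of_mem V ((rel_iff_of_mem V.2 (π.blockEmb_mem V x)).1 hr)
  obtain ⟨x', rfl⟩ := hmem p' h6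
  obtain ⟨y, rfl⟩ := hmem q (rel_trans h6 h8)
  obtain ⟨y', rfl⟩ := hmem q' (rel_trans (rel_trans h6 h8) h7)
  rw [OrderEmbedding.lt_iff_lt] at h1 h2 h3
  exact comap_rel.1 (hρ V x y x' y' h1 h2 h3 (comap_rel.2 h4) (comap_rel.2 h5))

/-- The Kreweras complement of the restriction of `ρ` to a block of a non-crossing partition
`π ≥ ρ` is the restriction of `π ⊓ K(ρ)`. -/
theorem comap_blockEmb_kreweras {π ρ : SetPart n} (hπ : π.IsNonCrossing) (h : ρ ≤ π)
    (V : {V // V ∈ π.parts}) :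
    (ρ.comap (π.blockEmb V)).kreweras = (π ⊓ ρ.kreweras).comap (π.blockEmb V) := by
  have key : ∀ x y, x ≤ y → ((ρ.comap (π.blockEmb V)).kreweras.Rel x y ↔
      ((π ⊓ ρ.kreweras).comap (π.blockEmb V)).Rel x y) := by
    intro x y hxy
    rw [comap_rel, inf_rel, kreweras_rel_of_le hxy, kreweras_rel_of_le (by simpa using hxy)]
    constructor
    · intro hr
      refine ⟨π.blockEmb_rel.2 rfl, ?_⟩
      intro p q hpq h1 h2
      by_cases hp : π.Rel (π.blockEmb V x) p
      · have hq := rel_trans hp (le_iff_rel.1 h _ _ hpq)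
        rw [rel_iff_of_mem V.2 (π.blockEmb_mem V x)] at hp hq
        obtain ⟨p, rfl⟩ := π.exists_blockEmb_of_mem V hp
        obtain ⟨q, rfl⟩ := π.exists_blockEmb_of_mem V hq
        simp only [OrderEmbedding.lt_iff_lt, OrderEmbedding.le_iff_le] at h1 h2 ⊢
        exact hr p q (comap_rel.2 hpq) h1 h2
      · have hrel : π.Rel (π.blockEmb V x) (π.blockEmb V y) := π.blockEmb_rel.2 rfl
        have := hπ.between hrel (le_iff_rel.1 h _ _ hpq) hp h1
          (lt_of_le_of_ne h2 fun e => hp (e ▸ hrel))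
        exact ⟨this.1, this.2.le⟩
    · rintro ⟨-, hr⟩ p q hpq h1 h2
      have := hr _ _ (comap_rel.1 hpq) ((π.blockEmb V).lt_iff_lt.2 h1)
        ((π.blockEmb V).le_iff_le.2 h2)
      simpa using this
  refine ext_rel fun x y => ?_
  rcases le_total x y with h1 | h1
  · exact key x y h1
  · exact ⟨fun hr => rel_symm ((key y x h1).1 (rel_symm hr)),
      fun hr => rel_symm ((key y x h1).2 (rel_symm hr))⟩

open Classical in
/-- A non-crossing refinement of a non-crossing partition amounts to a family of non-crossing
partitions of its blocks. -/
theorem prod_sum_NC_eq {R : Type*} [CommSemiring R] {π : SetPart n} (hπ : π.IsNonCrossing)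
    (Ψ : ∀ V : {V // V ∈ π.parts}, SetPart V.1.card → R) :
    ∏ V, ∑ τ ∈ NC V.1.card, Ψ V τ =
      ∑ ρ ∈ NC n with ρ ≤ π, ∏ V, Ψ V (ρ.comap (π.blockEmb V)) := by
  rw [Finset.prod_univ_sum]
  symm
  refine Finset.sum_bij (fun ρ _ V => ρ.comap (π.blockEmb V)) ?_ ?_ ?_ fun _ _ => rfl
  · intro ρ hρ
    rw [Fintype.mem_piFinset]
    exact fun V => mem_NC.2 ((mem_NC.1 (Finset.mem_filter.1 hρ).1).comap
      (π.blockEmb V).strictMono)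
  · intro ρ hρ ρ' hρ' heq
    exact ext_comap π.exists_blockEmb (le_iff_blockEmb.1 (Finset.mem_filter.1 hρ).2)
      (le_iff_blockEmb.1 (Finset.mem_filter.1 hρ').2) (congrFun heq)
  · intro τ hτ
    rw [Fintype.mem_piFinset] at hτ
    obtain ⟨ρ, h1, h2⟩ := exists_glue π.exists_blockEmb
      (fun V W x y heq => π.blockEmb_rel.1 (by rw [heq]; exact rel_refl π _)) τ
    have hle := le_iff_blockEmb.2 h1
    refine ⟨ρ, ?_, funext h2⟩
    rw [Finset.mem_filter, mem_NC]
    exact ⟨hπ.of_comap_blockEmb hle fun V => h2 V ▸ mem_NC.1 (hτ V), hle⟩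

end Blocks

/-! ### Bounds of the lattice of partitions -/

theorem top_rel {n : ℕ} (p q : Fin n) : (⊤ : SetPart n).Rel p q :=
  le_iff_rel.1 (le_top : ofSetoid ⊤ ≤ (⊤ : SetPart n)) p q ((ofSetoid_rel _ _ _).2 trivial)

theorem bot_rel {n : ℕ} {p q : Fin n} : (⊥ : SetPart n).Rel p q ↔ p = q := by
  constructor
  · exact fun h => (ofSetoid_rel ⊥ p q).1 (le_iff_rel.1 bot_le p q h)
  · rintro rfl
    exact rel_refl _ _

theorem isNonCrossing_top (n : ℕ) : (⊤ : SetPart n).IsNonCrossing :=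
  fun _ _ _ _ _ _ _ _ _ => top_rel _ _

theorem isNonCrossing_bot (n : ℕ) : (⊥ : SetPart n).IsNonCrossing := by
  intro p q p' q' h1 h2 _ h4 _
  exact absurd (bot_rel.1 h4) (h1.trans h2).ne

theorem kreweras_bot (n : ℕ) : (⊥ : SetPart n).kreweras = ⊤ := by
  refine ext_rel fun p q => ⟨fun _ => top_rel p q, fun _ => ?_⟩
  rw [kreweras_rel]
  intro x y hxy
  rw [bot_rel.1 hxy]

/-- Relative to itself, a partition has the discrete Kreweras complement. -/
theorem inf_kreweras_self {n : ℕ} (π : SetPart n) :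
    π ⊓ π.kreweras = ⊥ := by
  have key : ∀ p q, p < q → ¬ (π ⊓ π.kreweras).Rel p q := by
    intro p q hpq h
    rw [inf_rel, kreweras_rel_of_le hpq.le] at h
    exact absurd (h.2 q p (rel_symm h.1) hpq le_rfl).1 (lt_irrefl p)
  refine ext_rel fun p q => ?_
  rw [bot_rel]
  constructor
  · intro h
    rcases lt_trichotomy p q with h1 | h1 | h1
    · exact absurd h (key p q h1)
    · exact h1
    · exact absurd (rel_symm h) (key q p h1)
  · rintro rfl
    exact rel_refl _ _

theorem parts_top {n : ℕ} (hn : n ≠ 0) : (⊤ : SetPart n).parts = {Finset.univ} := by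
  have hall : ∀ V ∈ (⊤ : SetPart n).parts, V = Finset.univ := by
    intro V hV
    obtain ⟨x, hx⟩ := (⊤ : SetPart n).nonempty_of_mem_parts hV
    exact Finset.eq_univ_of_forall fun y => (rel_iff_of_mem hV hx).1 (top_rel x y)
  ext V
  rw [Finset.mem_singleton]
  refine ⟨hall V, ?_⟩
  rintro rfl
  exact mem_parts_of_rel (p := ⟨0, Nat.pos_of_ne_zero hn⟩) fun q => by simp [top_rel]

end SetPart

/-! ### Multiplicative extensions and their convolution -/

/-- The value at a subword may be computed with any increasing enumeration of the positions; this
absorbs the dependence of its length on `V`. -/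
theorem apply_restrictTo_eq {α β : Type*} (G : ∀ n, (Fin n → α) → β) {m n : ℕ} (w : Fin n → α)
    (V : Finset (Fin n)) (e : Fin m ↪o Fin n) (he : ∀ x, e x ∈ V) (hV : V.card = m) :
    G V.card (restrictTo w V) = G m (w ∘ e) := by
  subst hV
  have : ⇑e = V.orderEmbOfFin rfl := Finset.orderEmbOfFin_unique rfl he e.strictMono
  rw [this]
  rfl

section Convolution

variable {α R : Type*} [CommRing R]

/-- The multiplicative extension `G_π[w] = ∏_{V ∈ π} G(w|V)` of a family of functions `G n` of
words of length `n`. -/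
def partProd (G : ∀ n, (Fin n → α) → R) {n : ℕ} (w : Fin n → α) (π : SetPart n) : R :=
  ∏ V ∈ π.parts, G V.card (restrictTo w V)

/-- The boxed convolution for families of functions of words over an arbitrary alphabet. -/
noncomputable def conv (F G : ∀ n, (Fin n → α) → R) (n : ℕ) (w : Fin n → α) : R :=
  ∑ π ∈ SetPart.NC n, partProd F w π * partProd G w π.kreweras

/-- The multiplicative extension is a product over pieces of `[n]` which are unions of blocks. -/
theorem partProd_eq_prod_comap (G : ∀ n, (Fin n → α) → R) {n : ℕ} (w : Fin n → α) {ι : Type*}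
    [Fintype ι] {m : ι → ℕ} {e : ∀ i, Fin (m i) ↪o Fin n} {ρ : SetPart n}
    (he : ∀ p, ∃ i x, e i x = p) (hρ : ∀ i j x y, ρ.Rel (e i x) (e j y) → i = j) :
    partProd G w ρ = ∏ i, partProd G (w ∘ e i) (ρ.comap (e i)) := by
  rw [partProd, SetPart.prod_parts_eq_prod_comap he hρ]
  refine Finset.prod_congr rfl fun i _ => Finset.prod_congr rfl fun T _ => ?_
  refine apply_restrictTo_eq G w _ ((T.orderEmbOfFin rfl).trans (e i)) (fun x => ?_)
    (Finset.card_map _)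
  exact Finset.mem_map_of_mem _ (Finset.orderEmbOfFin_mem _ _ _)

theorem partProd_eq_prod_blocks (G : ∀ n, (Fin n → α) → R) {n : ℕ} (w : Fin n → α)
    {π ρ : SetPart n} (h : ρ ≤ π) :
    partProd G w ρ = ∏ V : {V // V ∈ π.parts},
      partProd G (restrictTo w V.1) (ρ.comap (π.blockEmb V)) :=
  partProd_eq_prod_comap G w π.exists_blockEmb (SetPart.le_iff_blockEmb.1 h)

theorem partProd_congr {F G : ∀ n, (Fin n → α) → R} {n : ℕ} {w : Fin n → α} {π : SetPart n}
    (h : ∀ V ∈ π.parts, F V.card (restrictTo w V) = G V.card (restrictTo w V)) :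
    partProd F w π = partProd G w π :=
  Finset.prod_congr rfl h

@[simp] theorem partProd_one {n : ℕ} (w : Fin n → α) (π : SetPart n) :
    partProd (fun _ _ => (1 : R)) w π = 1 :=
  Finset.prod_const_one

theorem partProd_top (G : ∀ n, (Fin n → α) → R) {n : ℕ} (hn : n ≠ 0) (w : Fin n → α) :
    partProd G w ⊤ = G n w := by
  rw [partProd, SetPart.parts_top hn, Finset.prod_singleton]
  exact apply_restrictTo_eq G w _ (RelEmbedding.refl _) (fun _ => Finset.mem_univ _) (by simp)

open Classical in
/-- The multiplicative extension of a convolution is a sum over refinements, since `π ⊓ K(ρ)` is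
the Kreweras complement of `ρ` relative to `π`. -/
theorem partProd_conv (F G : ∀ n, (Fin n → α) → R) {n : ℕ} (w : Fin n → α) {π : SetPart n}
    (hπ : π.IsNonCrossing) :
    partProd (conv F G) w π =
      ∑ ρ ∈ SetPart.NC n with ρ ≤ π, partProd F w ρ * partProd G w (π ⊓ ρ.kreweras) := by
  have h1 : partProd (conv F G) w π = ∏ V : {V // V ∈ π.parts}, ∑ τ ∈ SetPart.NC V.1.card,
      partProd F (restrictTo w V.1) τ * partProd G (restrictTo w V.1) τ.kreweras :=
    (Finset.prod_coe_sort π.parts fun V => conv F G V.card (restrictTo w V)).symm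
  rw [h1, SetPart.prod_sum_NC_eq hπ (fun V τ =>
    partProd F (restrictTo w V.1) τ * partProd G (restrictTo w V.1) τ.kreweras)]
  refine Finset.sum_congr rfl fun ρ hρ => ?_
  have hle := (Finset.mem_filter.1 hρ).2
  rw [Finset.prod_mul_distrib, partProd_eq_prod_blocks F w hle,
    partProd_eq_prod_blocks G w (inf_le_left : π ⊓ ρ.kreweras ≤ π)]
  simp only [SetPart.comap_blockEmb_kreweras hπ hle]

open Classical in
/-- The convolution is an incidence-algebra product: `(π, σ) ↦ F_{σ ⊓ K(π)}` is multiplicative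
in `F`. -/
theorem sum_interval_partProd (F G : ∀ n, (Fin n → α) → R) {n : ℕ} (w : Fin n → α)
    {π σ : SetPart n} (hπ : π.IsNonCrossing) (hσ : σ.IsNonCrossing) (h : π ≤ σ) :
    ∑ τ ∈ SetPart.NC n with π ≤ τ ∧ τ ≤ σ,
        partProd F w (τ ⊓ π.kreweras) * partProd G w (σ ⊓ τ.kreweras) =
      partProd (conv F G) w (σ ⊓ π.kreweras) := by
  rw [partProd_conv F G w (hσ.inf hπ.kreweras), ← SetPart.sum_interval_eq hπ hσ h]
  refine Finset.sum_congr rfl fun τ hτ => ?_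
  simp only [Finset.mem_filter, SetPart.mem_NC] at hτ
  rw [SetPart.kreweras_eq_inf hτ.1 hτ.2.1, inf_assoc]

/-- Both sides equal the sum of `F_ρ G_{π ⊓ K(ρ)} H_{K(π)}` over all `ρ ≤ π`. -/
theorem conv_assoc (F G H : ∀ n, (Fin n → α) → R) (n : ℕ) (w : Fin n → α) :
    conv (conv F G) H n w = conv F (conv G H) n w := by
  classical
  have h1 : conv (conv F G) H n w = ∑ π ∈ SetPart.NC n, ∑ ρ ∈ SetPart.NC n,
      if ρ ≤ π then partProd F w ρ * partProd G w (π ⊓ ρ.kreweras) * partProd H w π.kreweras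
        else 0 := by
    refine Finset.sum_congr rfl fun π hπ => ?_
    rw [partProd_conv F G w (SetPart.mem_NC.1 hπ), Finset.sum_mul, Finset.sum_filter]
  rw [h1, Finset.sum_comm]
  refine Finset.sum_congr rfl fun ρ hρ => ?_
  have hρ' := SetPart.mem_NC.1 hρ
  have h2 := sum_interval_partProd G H w hρ' (SetPart.isNonCrossing_top n) le_top
  simp only [le_top, and_true, top_inf_eq] at h2
  rw [← h2, Finset.mul_sum, ← Finset.sum_filter]
  exact Finset.sum_congr rfl fun π _ => mul_assoc _ _ _

/-- Convolution with the constant family `1` is injective: it is the passage from cumulants to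
moments. -/
theorem eq_of_conv_one_eq {F G : ∀ n, (Fin n → α) → R}
    (h : ∀ n, n ≠ 0 → ∀ w, conv F (fun _ _ => 1) n w = conv G (fun _ _ => 1) n w) :
    ∀ n, n ≠ 0 → ∀ w, F n w = G n w := by
  classical
  intro n
  induction n using Nat.strong_induction_on with
  | _ n ih =>
    intro hn w
    have hF : ∀ F : ∀ n, (Fin n → α) → R, conv F (fun _ _ => 1) n w =
        F n w + ∑ π ∈ (SetPart.NC n).erase ⊤, partProd F w π := by
      intro F
      simp only [conv, partProd_one, mul_one]
      rw [← Finset.add_sum_erase _ _ (SetPart.mem_NC.2 (SetPart.isNonCrossing_top n)),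
        partProd_top F hn]
    have := h n hn w
    rw [hF, hF] at this
    -- apart from the one-block partition, only values at shorter words enter
    have hrest : ∑ π ∈ (SetPart.NC n).erase ⊤, partProd F w π =
        ∑ π ∈ (SetPart.NC n).erase ⊤, partProd G w π := by
      refine Finset.sum_congr rfl fun π hπ => partProd_congr fun V hV => ?_
      have hπ' : Finset.univ ∉ π.parts := by
        intro hu
        refine Finset.ne_of_mem_erase hπ (SetPart.ext_rel fun p q => ?_)
        exact ⟨fun _ => SetPart.top_rel p q,
          fun _ => ⟨_, hu, Finset.mem_univ p, Finset.mem_univ q⟩⟩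
      exact ih _ (card_lt_of_mem_parts hπ' hV)
        (Finset.card_pos.2 (π.nonempty_of_mem_parts hV)).ne' _
    rw [hrest] at this
    exact add_right_cancel this

end Convolution

/-! ### Boxed convolution of series -/

theorem NCSeries.boxConv_coeff {s : ℕ} {R : Type u} [CommRing R] (f g : NCSeries s R) {n : ℕ}
    (hn : n ≠ 0) (w : Fin n → Fin s) : (f.boxConv g).coeff n w = conv f.coeff g.coeff n w :=
  if_neg hn

theorem NCSeries.ext_of_ne_zero {s : ℕ} {R : Type u} [CommRing R] {f g : NCSeries s R}
    (h : ∀ n, n ≠ 0 → ∀ w, f.coeff n w = g.coeff n w) : f = g := by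
  refine NCSeries.ext (funext fun n => funext fun w => ?_)
  rcases eq_or_ne n 0 with rfl | hn
  · rw [f.coeff_zero, g.coeff_zero]
  · exact h n hn w

theorem partProd_congr_of_ne_zero {α R : Type*} [CommRing R] {F G : ∀ n, (Fin n → α) → R}
    (h : ∀ n, n ≠ 0 → ∀ w, F n w = G n w) {n : ℕ} (w : Fin n → α) (π : SetPart n) :
    partProd F w π = partProd G w π :=
  partProd_congr fun _ hV => h _ (Finset.card_pos.2 (π.nonempty_of_mem_parts hV)).ne' _

theorem conv_congr {α R : Type*} [CommRing R] {F F' G G' : ∀ n, (Fin n → α) → R}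
    (hF : ∀ n, n ≠ 0 → ∀ w, F n w = F' n w) (hG : ∀ n, n ≠ 0 → ∀ w, G n w = G' n w)
    (n : ℕ) (w : Fin n → α) : conv F G n w = conv F' G' n w := by
  simp only [conv, partProd_congr_of_ne_zero hF, partProd_congr_of_ne_zero hG]

/-! ### Partitions of an alternating word -/

/-- The positions of the `ε`-th letters in a concatenation of `n` two-letter words. -/
def alternating (n : ℕ) (ε : Fin 2) : Fin n ↪o Fin (n * 2) :=
  OrderEmbedding.ofStrictMono (fun i => ⟨i * 2 + ε, by omega⟩) fun i j h => by
    rw [Fin.lt_def] at *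
    dsimp only
    omega

theorem exists_alternating {n : ℕ} (p : Fin (n * 2)) : ∃ ε i, alternating n ε i = p := by
  refine ⟨⟨p % 2, by omega⟩, ⟨p / 2, by omega⟩, Fin.ext ?_⟩
  change p.1 / 2 * 2 + p.1 % 2 = p.1
  omega

theorem alternating_disjoint {n : ℕ} (ε δ : Fin 2) (i j : Fin n)
    (h : alternating n ε i = alternating n δ j) : ε = δ := by
  have : i.1 * 2 + ε.1 = j.1 * 2 + δ.1 := congrArg Fin.val h
  omega

theorem alternating_lt {n : ℕ} {ε δ : Fin 2} {i j : Fin n} :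
    alternating n ε i < alternating n δ j ↔ i.1 * 2 + ε.1 < j.1 * 2 + δ.1 :=
  Iff.rfl

namespace SetPart

/-- Every block of the partition lies in the even or in the odd positions. -/
def IsSplit {n : ℕ} (ρ : SetPart (n * 2)) : Prop :=
  ∀ ε δ i j, ρ.Rel (alternating n ε i) (alternating n δ j) → ε = δ

/-- In a non-crossing partition whose blocks separate the two kinds of letters, the partition of
the second letters refines the Kreweras complement of the partition of the first letters. -/
theorem IsSplit.comap_le_kreweras {n : ℕ} {ρ : SetPart (n * 2)} (h : ρ.IsSplit)
    (hρ : ρ.IsNonCrossing) :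
    ρ.comap (alternating n 1) ≤ (ρ.comap (alternating n 0)).kreweras := by
  have key : ∀ i j, i ≤ j → (ρ.comap (alternating n 1)).Rel i j →
      (ρ.comap (alternating n 0)).kreweras.Rel i j := by
    intro i j hij hr
    rw [comap_rel] at hr
    rw [kreweras_rel_of_le hij]
    intro p q hpq h1 h2
    rw [comap_rel] at hpq
    have := hρ.between hr hpq (fun h3 => absurd (h _ _ _ _ h3) (by decide))
      (alternating_lt.2 (by simp; omega)) (alternating_lt.2 (by simp; omega))
    rw [alternating_lt, alternating_lt] at this
    simp only [Fin.isValue, Fin.val_one, Fin.val_zero] at this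
    exact ⟨Fin.lt_def.2 (by omega), Fin.le_def.2 (by omega)⟩
  rw [le_iff_rel]
  intro i j hr
  rcases le_total i j with h1 | h1
  · exact key i j h1 hr
  · exact rel_symm (key j i h1 (rel_symm hr))

/-- Conversely, a partition of the second letters which refines the Kreweras complement does not
cross the partition of the first letters. -/
theorem IsSplit.isNonCrossing {n : ℕ} {ρ : SetPart (n * 2)} (h : ρ.IsSplit)
    (h0 : ∀ ε, (ρ.comap (alternating n ε)).IsNonCrossing)
    (hle : ρ.comap (alternating n 1) ≤ (ρ.comap (alternating n 0)).kreweras) :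
    ρ.IsNonCrossing := by
  intro p q p' q' h1 h2 h3 h4 h5
  obtain ⟨ε, x, rfl⟩ := exists_alternating p
  obtain ⟨ε', x', rfl⟩ := exists_alternating p'
  obtain ⟨δ, y, rfl⟩ := exists_alternating q
  obtain ⟨δ', y', rfl⟩ := exists_alternating q'
  obtain rfl := h _ _ _ _ h4
  obtain rfl := h _ _ _ _ h5
  by_cases hεδ : ε = δ
  · subst hεδ
    rw [OrderEmbedding.lt_iff_lt] at h1 h2 h3
    exact comap_rel.1 (h0 ε x y x' y' h1 h2 h3 (comap_rel.2 h4) (comap_rel.2 h5))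
  · exfalso
    rw [alternating_lt] at h1 h2 h3
    have hval : (ε = 0 ∧ δ = 1) ∨ (ε = 1 ∧ δ = 0) := by omega
    rcases hval with ⟨rfl, rfl⟩ | ⟨rfl, rfl⟩
    · simp only [Fin.isValue, Fin.val_one, Fin.val_zero] at h1 h2 h3
      have := le_iff_rel.1 hle y y' (comap_rel.2 h5)
      rw [kreweras_rel_of_le (Fin.le_def.2 (by omega))] at this
      have := (this x' x (comap_rel.2 (rel_symm h4)) (Fin.lt_def.2 (by omega))
        (Fin.le_def.2 (by omega))).1
      rw [Fin.lt_def] at this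
      omega
    · simp only [Fin.isValue, Fin.val_one, Fin.val_zero] at h1 h2 h3
      have := le_iff_rel.1 hle x x' (comap_rel.2 h4)
      rw [kreweras_rel_of_le (Fin.le_def.2 (by omega))] at this
      have := (this y y' (comap_rel.2 h5) (Fin.lt_def.2 (by omega))
        (Fin.le_def.2 (by omega))).2
      rw [Fin.le_def] at this
      omega

end SetPart

open Classical in
/-- The sum over the split non-crossing partitions of an alternating word. -/
theorem sum_isSplit_eq_conv {α R : Type*} [CommRing R] (F : ∀ n, (Fin n → α) → R) {n : ℕ}
    (c : Fin (n * 2) → α) (u v : Fin n → α) (hu : c ∘ alternating n 0 = u)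
    (hv : c ∘ alternating n 1 = v) :
    ∑ ρ ∈ SetPart.NC (n * 2) with ρ.IsSplit, partProd F c ρ =
      ∑ π ∈ SetPart.NC n, partProd F u π *
        ∑ σ ∈ SetPart.NC n with σ ≤ π.kreweras, partProd F v σ := by
  simp only [Finset.mul_sum]
  rw [Finset.sum_sigma']
  refine Finset.sum_bij
    (fun ρ _ => ⟨ρ.comap (alternating n 0), ρ.comap (alternating n 1)⟩) ?_ ?_ ?_ ?_
  · intro ρ hρ
    simp only [Finset.mem_filter, SetPart.mem_NC, Finset.mem_sigma] at hρ ⊢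
    exact ⟨hρ.1.comap (alternating n 0).strictMono, hρ.1.comap (alternating n 1).strictMono,
      hρ.2.comap_le_kreweras hρ.1⟩
  · intro ρ hρ ρ' hρ' heq
    simp only [Finset.mem_filter] at hρ hρ'
    simp only [Sigma.mk.injEq, heq_eq_eq] at heq
    exact SetPart.ext_comap exists_alternating hρ.2 hρ'.2
      (Fin.forall_fin_two.2 ⟨heq.1, heq.2⟩)
  · rintro ⟨π, σ⟩ h
    simp only [Finset.mem_filter, SetPart.mem_NC, Finset.mem_sigma] at h
    obtain ⟨ρ, h1, h2⟩ := SetPart.exists_glue (e := alternating n) exists_alternating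
      alternating_disjoint ![π, σ]
    have e0 : ρ.comap (alternating n 0) = π := h2 0
    have e1 : ρ.comap (alternating n 1) = σ := h2 1
    refine ⟨ρ, ?_, by rw [e0, e1]⟩
    simp only [Finset.mem_filter, SetPart.mem_NC]
    refine ⟨SetPart.IsSplit.isNonCrossing h1 (Fin.forall_fin_two.2 ?_) ?_, h1⟩
    · rw [e0, e1]
      exact ⟨h.1, h.2.1⟩
    · rw [e0, e1]
      exact h.2.2
  · intro ρ hρ
    simp only [Finset.mem_filter] at hρ
    rw [partProd_eq_prod_comap F c exists_alternating hρ.2, Fin.prod_univ_two, hu, hv]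

/-! ### Cumulants of products of free elements -/

section Cumulants

variable {k : Type u} [CommRing k] {A : Type v} [Ring A] [Algebra k A]
  {R : Type u} [CommRing R] [Algebra k R] {s : ℕ}

/-- The family of the joint free cumulants of the tuple `a`. -/
noncomputable def cumulantFamily (φ : A →ₗ[k] R) (a : Fin s → A) (n : ℕ) (w : Fin n → Fin s) : R :=
  freeCumulant φ n (a ∘ w)

theorem rTransform_coeff (φ : A →ₗ[k] R) (a : Fin s → A) {n : ℕ} (hn : n ≠ 0)
    (w : Fin n → Fin s) : (rTransform φ a).coeff n w = cumulantFamily φ a n w :=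
  if_neg hn

theorem moment_eq_conv (φ : A →ₗ[k] R) (a : Fin s → A) {n : ℕ} (hn : n ≠ 0)
    (w : Fin n → Fin s) :
    φ (List.ofFn (a ∘ w)).prod = conv (cumulantFamily φ a) (fun _ _ => 1) n w := by
  rw [moment_cumulant φ n (Nat.one_le_iff_ne_zero.2 hn)]
  simp only [conv, partProd_one, mul_one]
  rfl

/-- The mixed moments of two free tuples, by the moment-cumulant formula: only the split
partitions contribute. -/
theorem moment_mul_eq_conv (φ : A →ₗ[k] R) (a b : Fin s → A)
    (hab : CombinatoriallyFree φ ![Set.range a, Set.range b]) {n : ℕ} (hn : n ≠ 0)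
    (w : Fin n → Fin s) :
    φ (List.ofFn ((a * b) ∘ w)).prod =
      conv (cumulantFamily φ a) (conv (cumulantFamily φ b) fun _ _ => 1) n w := by
  classical
  -- the alternating tuple `a, b, a, b, …` along `w`
  let c : Fin (n * 2) → A := fun p => (![a, b] : Fin 2 → Fin s → A) p.modNat (w p.divNat)
  have hdiv : ∀ ε i, (alternating n ε i).divNat = i := by
    intro ε i
    apply Fin.ext
    change (i.1 * 2 + ε.1) / 2 = i.1
    omega
  have hmod : ∀ ε i, (alternating n ε i).modNat = ε := by
    intro ε i
    apply Fin.ext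
    change (i.1 * 2 + ε.1) % 2 = ε.1
    omega
  have hprod : (List.ofFn ((a * b) ∘ w)).prod = (List.ofFn c).prod := by
    rw [List.ofFn_mul, List.prod_flatten, List.map_ofFn]
    refine congrArg List.prod (congrArg List.ofFn (funext fun i => ?_))
    have h0 : (⟨i.1 * 2 + (0 : Fin 2).1, by omega⟩ : Fin (n * 2)) = alternating n 0 i := rfl
    have h1 : (⟨i.1 * 2 + (1 : Fin 2).1, by omega⟩ : Fin (n * 2)) = alternating n 1 i := rfl
    simp only [Function.comp_apply, List.ofFn_succ, List.ofFn_zero, List.prod_cons,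
      List.prod_nil, mul_one, Fin.succ_zero_eq_one, h0, h1, c, hdiv, hmod]
    rfl
  rw [hprod, moment_cumulant φ _ (by omega)]
  change ∑ ρ ∈ SetPart.NC (n * 2), partProd (freeCumulant φ) c ρ = _
  have hsplit : ∑ ρ ∈ SetPart.NC (n * 2), partProd (freeCumulant φ) c ρ =
      ∑ ρ ∈ SetPart.NC (n * 2) with ρ.IsSplit, partProd (freeCumulant φ) c ρ := by
    symm
    refine Finset.sum_filter_of_ne fun ρ _ hne => ?_
    intro ε δ i j hr
    by_contra hεδ
    obtain ⟨V, hV, h1, h2⟩ := hr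
    -- a block with positions of both kinds contributes a mixed cumulant
    refine hne (Finset.prod_eq_zero hV ?_)
    have hran : ∀ p : Fin (n * 2), p ∈ V → ∃ x, V.orderEmbOfFin rfl x = p := by
      intro p hp
      have : p ∈ Set.range (V.orderEmbOfFin rfl) := by
        rw [Finset.range_orderEmbOfFin]
        exact hp
      exact this
    obtain ⟨x, hx⟩ := hran _ h1
    obtain ⟨y, hy⟩ := hran _ h2
    refine hab _ _ (fun z => (V.orderEmbOfFin rfl z).modNat) (fun z => ?_) ⟨x, y, ?_⟩
    · change (![a, b] : Fin 2 → Fin s → A) _ _ ∈ _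
      generalize (V.orderEmbOfFin rfl z).modNat = ε
      fin_cases ε
      · exact Set.mem_range_self _
      · exact Set.mem_range_self _
    · rw [hx, hy, hmod, hmod]
      exact hεδ
  rw [hsplit, sum_isSplit_eq_conv (freeCumulant φ) c (a ∘ w) (b ∘ w)]
  · refine Finset.sum_congr rfl fun π hπ => ?_
    rw [partProd_conv _ _ w (SetPart.mem_NC.1 hπ).kreweras]
    simp only [partProd_one, mul_one]
    rfl
  · funext i
    simp only [Function.comp_apply, c, hdiv, hmod]
    rfl
  · funext i
    simp only [Function.comp_apply, c, hdiv, hmod]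
    rfl

/-- The `R`-transform turns the product of free tuples into the boxed convolution: the moments of
`a ⋆ b` are `R(a ⋆ b) ⊠ 1` and also `R(a) ⊠ (R(b) ⊠ 1)`, and `⊠ 1` can be cancelled. -/
theorem rTransform_mul (φ : A →ₗ[k] R) (a b : Fin s → A)
    (hab : CombinatoriallyFree φ ![Set.range a, Set.range b]) :
    rTransform φ (a * b) = (rTransform φ a).boxConv (rTransform φ b) := by
  refine NCSeries.ext_of_ne_zero fun n hn w => ?_
  rw [rTransform_coeff φ _ hn, NCSeries.boxConv_coeff _ _ hn,
    conv_congr (fun n hn => rTransform_coeff φ a hn) (fun n hn => rTransform_coeff φ b hn)]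
  refine eq_of_conv_one_eq (fun n hn w => ?_) n hn w
  rw [← moment_eq_conv φ _ hn, moment_mul_eq_conv φ a b hab hn, conv_assoc]

/-- The distribution is determined by the moments, because the words span the free algebra. -/
theorem distribution_eq_iff (φ : A →ₗ[k] R) (a b : Fin s → A) :
    distribution φ a = distribution φ b ↔
      ∀ (n : ℕ) (w : Fin n → Fin s), φ (List.ofFn (a ∘ w)).prod = φ (List.ofFn (b ∘ w)).prod := by
  have hword : ∀ (c : Fin s → A) (l : List (Fin s)),
      distribution φ c (l.map (FreeAlgebra.ι k)).prod = φ (l.map c).prod := by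
    intro c l
    simp [distribution, map_list_prod, Function.comp_def]
  constructor
  · intro h n w
    have := hword a (List.ofFn w)
    rw [h, hword b, List.map_ofFn, List.map_ofFn] at this
    exact this.symm
  · intro h
    refine LinearMap.ext_on_range (v := fun l : List (Fin s) => (l.map (FreeAlgebra.ι k)).prod)
      ?_ fun l => ?_
    · rw [eq_top_iff]
      have htop : (⊤ : Submodule k (FreeAlgebra k (Fin s))) =
          Submodule.span k
            (Submonoid.closure (Set.range (FreeAlgebra.ι k (X := Fin s))) : Set _) := by
        rw [← Algebra.adjoin_eq_span, FreeAlgebra.adjoin_range_ι, Algebra.top_toSubmodule]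
      rw [htop]
      refine Submodule.span_mono ?_
      intro x hx
      obtain ⟨l, hl, rfl⟩ := Submonoid.exists_list_of_mem_closure hx
      obtain ⟨l, rfl⟩ : l ∈ Set.range (List.map (FreeAlgebra.ι k (X := Fin s))) := by
        rw [Set.range_list_map]
        exact hl
      exact ⟨l, rfl⟩
    · rw [hword, hword]
      have := h l.length l.get
      rwa [← List.map_ofFn, ← List.map_ofFn, List.ofFn_get] at this

/-- Moments and free cumulants determine each other. -/
theorem rTransform_eq_iff (φ : A →ₗ[k] R) (a b : Fin s → A) :
    rTransform φ a = rTransform φ b ↔ distribution φ a = distribution φ b := by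
  rw [distribution_eq_iff]
  constructor
  · intro h n w
    rcases eq_or_ne n 0 with rfl | hn
    · simp
    · rw [moment_eq_conv φ a hn, moment_eq_conv φ b hn]
      refine conv_congr (fun n hn w => ?_) (fun _ _ _ => rfl) n w
      rw [← rTransform_coeff φ a hn, ← rTransform_coeff φ b hn, h]
  · intro h
    refine NCSeries.ext_of_ne_zero fun n hn w => ?_
    rw [rTransform_coeff φ a hn, rTransform_coeff φ b hn]
    refine eq_of_conv_one_eq (fun n hn w => ?_) n hn w
    rw [← moment_eq_conv φ a hn, ← moment_eq_conv φ b hn, h]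

end Cumulants

/-! ### Enumeration by height -/

/-- An infinite set with a function `h` to `ℕ` with finite sublevel sets can be enumerated in order
of increasing `h`. -/
theorem exists_equiv_nat_of_height {X : Type*} [Infinite X] (h : X → ℕ)
    (hfin : ∀ m, {x | h x ≤ m}.Finite) : ∃ e : X ≃ ℕ, ∀ x y, h x < h y → e x < e y := by
  classical
  have hc : Countable X := by
    rw [← Set.countable_univ_iff]
    refine (Set.countable_iUnion fun m => (hfin m).countable).mono fun x _ => ?_
    exact Set.mem_iUnion.2 ⟨h x, le_refl (h x)⟩
  obtain ⟨c, hc⟩ := exists_injective_nat X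
  -- order `X` by `h`, ties being broken by `c`; the position in this order is the number of
  -- predecessors
  let key : X → ℕ ×ₗ ℕ := fun x => toLex (h x, c x)
  have hkey : ∀ x y, key x < key y ↔ h x < h y ∨ h x = h y ∧ c x < c y := fun x y =>
    Prod.Lex.toLex_lt_toLex
  have hinj : Function.Injective key := fun x y hxy =>
    hc (congrArg (fun p => (ofLex p).2) hxy)
  have hbelow : ∀ x, {y | key y < key x}.Finite := by
    refine fun x => (hfin (h x)).subset fun y hy => ?_
    rcases (hkey y x).1 hy with h1 | h1
    · exact h1.le
    · exact h1.1.le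
  let j : X → ℕ := fun x => {y | key y < key x}.ncard
  have hmono : ∀ x y, key x < key y → j x < j y := fun x y hxy =>
    Set.ncard_lt_ncard ⟨fun z hz => lt_trans hz hxy, fun hsub => lt_irrefl (key x) (hsub hxy)⟩ (hbelow y)
  have hj : Function.Injective j := by
    intro x y hxy
    rcases lt_trichotomy (key x) (key y) with h1 | h1 | h1
    · exact absurd hxy (hmono x y h1).ne
    · exact hinj h1
    · exact absurd hxy (hmono y x h1).ne'
  have : Infinite (Set.range j) := (Equiv.ofInjective j hj).infinite_iff.1 inferInstance
  refine ⟨(Equiv.ofInjective j hj).trans (Nat.Subtype.orderIsoOfNat (Set.range j)).symm.toEquiv,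
    fun x y hxy => ?_⟩
  exact (Nat.Subtype.orderIsoOfNat (Set.range j)).symm.lt_iff_lt.2
    (show j x < j y from hmono x y ((hkey x y).2 (Or.inl hxy)))

/-! ### The incidence representation -/

/-- The basis of the incidence representation: words together with a non-crossing partition of
their positions. -/
abbrev IncidenceIndex (s : ℕ) : Type :=
  Σ q : (Σ n : ℕ, Fin n → Fin s), {π : SetPart q.1 // π.IsNonCrossing}

namespace IncidenceIndex

variable {s : ℕ}

open Classical in
/-- A function with finite sublevel sets which is strictly monotone in the partition. -/
noncomputable def height (x : IncidenceIndex s) : ℕ :=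
  x.1.1 + (Finset.univ.filter fun τ : SetPart x.1.1 => τ ≤ x.2.1).card

theorem height_lt {q : Σ n : ℕ, Fin n → Fin s} {π σ : {π : SetPart q.1 // π.IsNonCrossing}}
    (h : π < σ) : height ⟨q, π⟩ < height ⟨q, σ⟩ := by
  classical
  refine Nat.add_lt_add_left (Finset.card_lt_card ⟨?_, fun hsub => ?_⟩) _
  · intro τ hτ
    simp only [Finset.mem_filter, Finset.mem_univ, true_and] at hτ ⊢
    exact hτ.trans h.le
  · have : σ.1 ∈ Finset.univ.filter fun τ : SetPart q.1 => τ ≤ π.1 := hsub (by simp)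
    simp only [Finset.mem_filter, Finset.mem_univ, true_and] at this
    exact absurd h (not_lt_of_ge this)

theorem finite_height_le (m : ℕ) : {x : IncidenceIndex s | x.height ≤ m}.Finite := by
  let g : (Σ n : Fin (m + 1), Σ _ : Fin n → Fin s, {π : SetPart n // π.IsNonCrossing}) →
      IncidenceIndex s := fun y => ⟨⟨y.1, y.2.1⟩, y.2.2⟩
  refine (Set.finite_range g).subset ?_
  rintro ⟨⟨n, w⟩, π⟩ hx
  have hn : n ≤ m := (Nat.le_add_right _ _).trans hx
  exact ⟨⟨⟨n, Nat.lt_succ_of_le hn⟩, w, π⟩, rfl⟩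

theorem infinite (hs : 1 ≤ s) : Infinite (IncidenceIndex s) := by
  refine Infinite.of_injective
    (fun n : ℕ => (⟨⟨n, fun _ => ⟨0, hs⟩⟩, ⟨⊥, SetPart.isNonCrossing_bot n⟩⟩ : IncidenceIndex s))
    fun m n h => ?_
  exact congrArg (fun x : IncidenceIndex s => x.1.1) h

theorem exists_enumeration (hs : 1 ≤ s) :
    ∃ e : IncidenceIndex s ≃ ℕ, ∀ x y, height x < height y → e x < e y :=
  have := infinite hs
  exists_equiv_nat_of_height height finite_height_le

end IncidenceIndex

section Incidence

variable {s : ℕ} {R : Type*} [CommRing R]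

open Classical in
/-- The matrix of the incidence representation: for a word `w` and non-crossing partitions
`π ≤ σ` of its positions, the entry is `F_{σ ⊓ K(π)}[w]`; all other entries vanish. -/
noncomputable def incidenceEntry (F : ∀ n, (Fin n → Fin s) → R) (x y : IncidenceIndex s) : R :=
  if h : x.1 = y.1 then
    if (h ▸ x.2).1 ≤ y.2.1 then partProd F y.1.2 (y.2.1 ⊓ (h ▸ x.2).1.kreweras) else 0
  else 0

theorem incidenceEntry_of_le (F : ∀ n, (Fin n → Fin s) → R) {q : Σ n : ℕ, Fin n → Fin s}
    {π σ : {π : SetPart q.1 // π.IsNonCrossing}} (h : π ≤ σ) :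
    incidenceEntry F ⟨q, π⟩ ⟨q, σ⟩ = partProd F q.2 (σ.1 ⊓ π.1.kreweras) := by
  rw [incidenceEntry, dif_pos rfl]
  exact if_pos h

theorem exists_of_incidenceEntry_ne_zero {F : ∀ n, (Fin n → Fin s) → R} {x y : IncidenceIndex s}
    (h : incidenceEntry F x y ≠ 0) : ∃ q π σ, π ≤ σ ∧ x = ⟨q, π⟩ ∧ y = ⟨q, σ⟩ := by
  obtain ⟨q, π⟩ := x
  obtain ⟨q', σ⟩ := y
  by_cases hq : q = q'
  · subst hq
    refine ⟨q, π, σ, ?_, rfl, rfl⟩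
    by_contra hle
    refine h ?_
    rw [incidenceEntry, dif_pos rfl]
    exact if_neg hle
  · exact absurd (dif_neg hq) h

theorem eq_or_height_lt_of_incidenceEntry_ne_zero {F : ∀ n, (Fin n → Fin s) → R}
    {x y : IncidenceIndex s} (h : incidenceEntry F x y ≠ 0) : x = y ∨ x.height < y.height := by
  obtain ⟨q, π, σ, hle, rfl, rfl⟩ := exists_of_incidenceEntry_ne_zero h
  rcases hle.eq_or_lt with rfl | hlt
  · exact Or.inl rfl
  · exact Or.inr (IncidenceIndex.height_lt hlt)

theorem incidenceEntry_congr {F G : ∀ n, (Fin n → Fin s) → R}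
    (h : ∀ n, n ≠ 0 → ∀ w, F n w = G n w) (x y : IncidenceIndex s) :
    incidenceEntry F x y = incidenceEntry G x y := by
  simp only [incidenceEntry, partProd_congr_of_ne_zero h]

theorem map_incidenceEntry {R' : Type*} [CommRing R'] (φ : R →+* R')
    (F : ∀ n, (Fin n → Fin s) → R) (x y : IncidenceIndex s) :
    incidenceEntry (fun n w => φ (F n w)) x y = φ (incidenceEntry F x y) := by
  unfold incidenceEntry
  split_ifs
  · exact (map_prod φ _ _).symm
  · exact (map_zero φ).symm
  · exact (map_zero φ).symm

/-- The diagonal entry at `(w, π)` is `∏ F(w_p)` over all positions `p`, whatever `π` is. -/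
theorem isUnit_incidenceEntry_self {F : ∀ n, (Fin n → Fin s) → R}
    (hF : ∀ i, IsUnit (F 1 fun _ => i)) (x : IncidenceIndex s) : IsUnit (incidenceEntry F x x) := by
  obtain ⟨q, π⟩ := x
  rw [incidenceEntry_of_le F le_rfl, SetPart.inf_kreweras_self, partProd, IsUnit.prod_iff]
  intro V hV
  obtain ⟨p, -, rfl⟩ := Finpartition.mem_bot_iff.1 hV
  rw [apply_restrictTo_eq F q.2 {p} (OrderEmbedding.ofStrictMono (fun _ : Fin 1 => p)
    (Subsingleton.strictMono _)) (fun _ => Finset.mem_singleton_self p) (Finset.card_singleton p)]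
  exact hF (q.2 p)

/-- Every coefficient of a series occurs as an entry of its incidence matrix. -/
theorem incidenceEntry_bot_top (F : ∀ n, (Fin n → Fin s) → R) {n : ℕ} (hn : n ≠ 0)
    (w : Fin n → Fin s) :
    incidenceEntry F ⟨⟨n, w⟩, ⟨⊥, SetPart.isNonCrossing_bot n⟩⟩
      ⟨⟨n, w⟩, ⟨⊤, SetPart.isNonCrossing_top n⟩⟩ = F n w := by
  rw [incidenceEntry_of_le F (Subtype.coe_le_coe.1 bot_le), SetPart.kreweras_bot, inf_idem,
    partProd_top F hn]

/-- Multiplicativity of the incidence matrix. Only the finitely many `z` between `x` and `y`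
contribute, so the sum may be taken over any finite set which contains them. -/
theorem sum_incidenceEntry_mul (F G : ∀ n, (Fin n → Fin s) → R) {x y : IncidenceIndex s}
    {S : Finset (IncidenceIndex s)} (hS : ∀ z, z = y ∨ z.height < y.height → z ∈ S) :
    ∑ z ∈ S, incidenceEntry F x z * incidenceEntry G z y = incidenceEntry (conv F G) x y := by
  classical
  have hterm : ∀ z, incidenceEntry F x z * incidenceEntry G z y ≠ 0 →
      ∃ q π τ σ, π ≤ τ ∧ τ ≤ σ ∧ x = ⟨q, π⟩ ∧ z = ⟨q, τ⟩ ∧ y = ⟨q, σ⟩ := by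
    intro z hz
    obtain ⟨q, π, τ, h1, hx, hz1⟩ := exists_of_incidenceEntry_ne_zero (left_ne_zero_of_mul hz)
    obtain ⟨q', τ', σ, h2, hz2, hy⟩ := exists_of_incidenceEntry_ne_zero (right_ne_zero_of_mul hz)
    subst hz1
    cases hz2
    exact ⟨q, π, τ, σ, h1, h2, hx, rfl, hy⟩
  by_cases hxy : ∃ q π σ, π ≤ σ ∧ x = ⟨q, π⟩ ∧ y = ⟨q, σ⟩
  · obtain ⟨q, π, σ, hπσ, rfl, rfl⟩ := hxy
    rw [incidenceEntry_of_le _ hπσ, ← sum_interval_partProd F G q.2 π.2 σ.2 hπσ]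
    symm
    refine (Finset.sum_subtype (F := Fintype.ofFinite _)
      (p := fun τ => τ.IsNonCrossing ∧ π.1 ≤ τ ∧ τ ≤ σ.1) _ (fun τ => by simp [SetPart.mem_NC]) _).trans ?_
    refine Finset.sum_of_injOn (fun τ => ⟨q, ⟨τ.1, τ.2.1⟩⟩) ?_ ?_ ?_ ?_
    · intro τ _ τ' _ h
      simpa [Subtype.ext_iff] using h
    · intro τ _
      refine hS _ ?_
      rcases (show (⟨τ.1, τ.2.1⟩ : {π : SetPart q.1 // π.IsNonCrossing}) ≤ σ
        from τ.2.2.2).eq_or_lt with h | h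
      · exact Or.inl (congrArg (Sigma.mk q) h)
      · exact Or.inr (IncidenceIndex.height_lt h)
    · intro z _ hz
      by_contra hne
      obtain ⟨q', π', τ, σ', h1, h2, h3, rfl, h4⟩ := hterm z hne
      cases h3
      cases h4
      exact hz ⟨⟨τ.1, τ.2, h1, h2⟩, by simp, rfl⟩
    · intro τ _
      rw [incidenceEntry_of_le F (show π ≤ ⟨τ.1, τ.2.1⟩ from τ.2.2.1),
        incidenceEntry_of_le G (show ⟨τ.1, τ.2.1⟩ ≤ σ from τ.2.2.2)]
  · have hzero : incidenceEntry (conv F G) x y = 0 := by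
      by_contra hne
      exact hxy (exists_of_incidenceEntry_ne_zero hne)
    rw [hzero]
    refine Finset.sum_eq_zero fun z _ => ?_
    by_contra hne
    obtain ⟨q, π, τ, σ, h1, h2, h3, -, h4⟩ := hterm z hne
    exact hxy ⟨q, π, σ, h1.trans h2, h3, h4⟩

end Incidence

section Representation

variable {s : ℕ} {R : Type u} [CommRing R]

/-- The upper left `N × N` block of the incidence matrix, for an enumeration of the basis. -/
noncomputable def incidenceMatrix (e : IncidenceIndex s ≃ ℕ) (f : GSeries s R) (N : ℕ) :
    Matrix (Fin N) (Fin N) R :=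
  Matrix.of fun i j => incidenceEntry f.1.coeff (e.symm i) (e.symm j)

theorem incidenceMatrix_eq_zero {e : IncidenceIndex s ≃ ℕ}
    (he : ∀ x y, x.height < y.height → e x < e y) (f : GSeries s R) {N : ℕ} {i j : Fin N}
    (hij : j < i) : incidenceMatrix e f N i j = 0 := by
  by_contra hne
  rcases eq_or_height_lt_of_incidenceEntry_ne_zero hne with h | h
  · exact hij.ne' (Fin.ext (e.symm.injective h))
  · have := he _ _ h
    rw [e.apply_symm_apply, e.apply_symm_apply] at this
    exact absurd hij (not_lt_of_gt this)

theorem isUnit_det_incidenceMatrix {e : IncidenceIndex s ≃ ℕ}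
    (he : ∀ x y, x.height < y.height → e x < e y) (f : GSeries s R) (N : ℕ) :
    IsUnit (incidenceMatrix e f N).det := by
  have hM : (incidenceMatrix e f N).BlockTriangular id :=
    fun i j hij => incidenceMatrix_eq_zero he f hij
  rw [Matrix.det_of_isUpperTriangular hM, IsUnit.prod_iff]
  exact fun i _ => isUnit_incidenceEntry_self f.2 _

theorem incidenceMatrix_mul {e : IncidenceIndex s ≃ ℕ}
    (he : ∀ x y, x.height < y.height → e x < e y) (f g : GSeries s R) (N : ℕ) :
    incidenceMatrix e (f * g) N = incidenceMatrix e f N * incidenceMatrix e g N := by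
  ext i j
  have h1 : incidenceMatrix e (f * g) N i j =
      incidenceEntry (conv f.1.coeff g.1.coeff) (e.symm i) (e.symm j) :=
    incidenceEntry_congr (fun n hn w => NCSeries.boxConv_coeff f.1 g.1 hn w) _ _
  let ι : Fin N ↪ IncidenceIndex s := Fin.valEmbedding.trans e.symm.toEmbedding
  rw [h1, Matrix.mul_apply, ← sum_incidenceEntry_mul (S := Finset.univ.map ι), Finset.sum_map]
  · rfl
  · intro z hz
    have hlt : e z < N := by
      rcases hz with rfl | hz
      · simp
      · have := he _ _ hz
        rw [e.apply_symm_apply] at this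
        exact this.trans j.2
    exact Finset.mem_map.2 ⟨⟨e z, hlt⟩, Finset.mem_univ _, e.symm_apply_apply z⟩

/-- The incidence representation `f ↦ (f_{w, σ ⊓ K(π)})` of `𝔊ˢ`, in an enumeration of its basis
which makes it upper triangular. -/
noncomputable def incidenceRep (k : Type u) [Field k] {e : IncidenceIndex s ≃ ℕ}
    (he : ∀ x y, x.height < y.height → e x < e y) : TriangularRep k s where
  app R _ _ :=
    { toFun := fun f =>
        ⟨fun N => ⟨Matrix.nonsingInvUnit _ (isUnit_det_incidenceMatrix he f N),
          fun _ _ hij => incidenceMatrix_eq_zero he f hij⟩, fun _ => Subtype.ext (Units.ext rfl)⟩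
      map_mul' := fun f g => Subtype.ext (funext fun N =>
        Subtype.ext (Units.ext (incidenceMatrix_mul he f g N))) }
  naturality R R' _ _ _ _ h f N := by
    ext i j
    exact map_incidenceEntry h.toRingHom f.1.coeff _ _

theorem incidenceRep_isFaithful (k : Type u) [Field k] {e : IncidenceIndex s ≃ ℕ}
    (he : ∀ x y, x.height < y.height → e x < e y) : (incidenceRep k he).IsFaithful := by
  intro R _ _ f g hfg
  refine Subtype.ext (NCSeries.ext_of_ne_zero fun n hn w => ?_)
  have hentry : ∀ x y, incidenceEntry f.1.coeff x y = incidenceEntry g.1.coeff x y := by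
    intro x y
    let N := max (e x) (e y) + 1
    have hM : incidenceMatrix e f N = incidenceMatrix e g N :=
      congrArg (fun m : BorelLim R => BorelGroup.mat (m.1 N)) hfg
    have := congrFun (congrFun hM ⟨e x, by omega⟩) ⟨e y, by omega⟩
    simpa [incidenceMatrix] using this
  rw [← incidenceEntry_bot_top f.1.coeff hn w, hentry, incidenceEntry_bot_top _ hn]

end Representation

/-! ### Absence of faithful representations of finite degree -/

/-- The matrix entries of a representation of finite degree are polynomials in finitely many of the
coefficients of the series, hence do not see the coefficients of long words. -/
theorem not_hasFaithfulRepOfDegree (k : Type u) [Field k] {s : ℕ} (hs : 1 ≤ s) (N : ℕ) :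
    ¬ HasFaithfulRepOfDegree k s N := by
  classical
  rintro ⟨σ, hnat, hinj⟩
  -- the series whose coefficients at words of length `n ≥ 2` are the indeterminate `X n`
  let f : GSeries s (MvPolynomial ℕ k) :=
    ⟨{ coeff := fun n _ => if n = 0 then 0 else if n = 1 then 1 else MvPolynomial.X n
       coeff_zero := fun _ => rfl }, fun _ => isUnit_one⟩
  let M : Matrix (Fin N) (Fin N) (MvPolynomial ℕ k) := (σ _ f).1
  let S : Finset ℕ := Finset.univ.biUnion fun i => Finset.univ.biUnion fun j => (M i j).vars
  obtain ⟨n, hn⟩ := Infinite.exists_notMem_finset (S ∪ Finset.range 2)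
  rw [Finset.mem_union, not_or, Finset.mem_range, not_lt] at hn
  let h (c : k) : MvPolynomial ℕ k →ₐ[k] k := MvPolynomial.aeval (Pi.single n c)
  have hM : M.map (h 0) = M.map (h 1) := by
    ext i j
    refine MvPolynomial.eval₂Hom_congr' rfl (fun m hm _ => ?_) rfl
    have hmn : m ≠ n := by
      rintro rfl
      exact hn.1 (Finset.mem_biUnion.2 ⟨i, Finset.mem_univ i,
        Finset.mem_biUnion.2 ⟨j, Finset.mem_univ j, hm⟩⟩)
    rw [Pi.single_eq_of_ne hmn, Pi.single_eq_of_ne hmn]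
  have heq : f.map (h 0).toRingHom = f.map (h 1).toRingHom := by
    refine hinj k (Units.ext ?_)
    rw [hnat, hnat]
    exact hM
  have hcoeff : ∀ c, (f.map (h c).toRingHom).1.coeff n (fun _ => ⟨0, hs⟩) = c := by
    intro c
    change h c (if n = 0 then 0 else if n = 1 then 1 else MvPolynomial.X n) = c
    rw [if_neg (by omega), if_neg (by omega)]
    simp [h]
  exact zero_ne_one (α := k) (by rw [← hcoeff 0, heq, hcoeff])

/-! ### The `S`-transform -/

theorem mainTheorem3 (k : Type u) [Field k] (s : ℕ) (hs : 1 ≤ s) :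
    (∃ ρ : TriangularRep k s, ρ.IsMinimalFaithful) ∧
    ∀ ρ : TriangularRep k s, ρ.IsFaithful →
      ∀ (A : Type v) [Ring A] [Algebra k A] (φ : A →ₗ[k] k), φ 1 = 1 →
        (∀ (a b : Fin s → A) (ha : ∀ i, IsUnit (φ (a i))) (hb : ∀ i, IsUnit (φ (b i))),
          sTransform ρ φ a ha = sTransform ρ φ b hb ↔ distribution φ a = distribution φ b) ∧
        (∀ (a b : Fin s → A) (ha : ∀ i, IsUnit (φ (a i))) (hb : ∀ i, IsUnit (φ (b i))),
          CombinatoriallyFree φ ![Set.range a, Set.range b] →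
            ∃ hab : ∀ i, IsUnit (φ ((a * b) i)),
              sTransform ρ φ (a * b) hab = sTransform ρ φ a ha * sTransform ρ φ b hb) := by
  refine ⟨?_, fun ρ hρ A _ _ φ _ => ⟨fun a b ha hb => ?_, fun a b ha hb hfree => ?_⟩⟩
  · obtain ⟨e, he⟩ := IncidenceIndex.exists_enumeration hs
    exact ⟨incidenceRep k he, incidenceRep_isFaithful k he, not_hasFaithfulRepOfDegree k hs⟩
  · rw [← rTransform_eq_iff]
    exact (hρ k).eq_iff.trans Subtype.ext_iff
  · have hmul := rTransform_mul φ a b hfree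
    have hab : ∀ i, IsUnit (φ ((a * b) i)) := by
      intro i
      -- compare the coefficients of `z_i`
      have := congrArg (fun f : NCSeries s k => f.coeff 1 fun _ => i) hmul
      simp only [NCSeries.boxConv_coeff_one, rTransform, one_ne_zero, if_false,
        freeCumulant_one] at this
      rw [this]
      exact (ha i).mul (hb i)
    refine ⟨hab, ?_⟩
    have hG : rTransformG φ (a * b) hab = rTransformG φ a ha * rTransformG φ b hb :=
      Subtype.ext hmul
    rw [sTransform, hG, map_mul]
    rfl
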